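/- Let $n,d\ge 1$, let $\mathcal D$ be the family of all dyadic cubes $Q=2^{-k}(m+[0,1)^d)$, $k\in\mathbb Z$, $m\in\mathbb Z^d$, let $K:\mathcal D\to[0,\infty)$ be a map and let $\sigma_1,\dots,\sigma_n$ be locally finite positive Borel measures on $\mathbb R^d$. Let $1<p_i<\infty$ with $\sum_{i=1}^n\frac1{p_i}<1$. For a permutation $\phi\in S_n$ define $r^\phi_0=1$, and $r^\phi_j$ $(1\le j\le n-1)$ and $r$ by $$\frac1{r^\phi_j}+\sum_{i=1}^{j}\frac1{p_{\phi(i)}}=1,\qquad \frac1r+\sum_{i=1}^n\frac1{p_i}=1 .$$ Put $K^\phi_0=K$ and, inductively for $j=1,\dots,n-1$ and $Q\in\mathcal D$, $$K^\phi_j(Q)=K^\phi_{j-1}(Q)\,\sigma_{\phi(j)}(Q)\Bigl(\frac1{\sigma_{\phi(j)}(Q)}\sum_{Q'\in\mathcal D,\,Q'\subset Q}K^\phi_{j-1}(Q')\prod_{i=j}^n\sigma_{\phi(i)}(Q')\Bigr)^{r^\phi_j/r^\phi_{j-1}-1}\in[0,\infty],$$ with $0\cdot\infty=0$, and with $K^\phi_j(Q)=0$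 if $\sigma_{\phi(j)}(Q)=0$. The following statements are equivalent: (a) there is $c_1<\infty$ such that, for all $f_i\in L^{p_i}(\sigma_i)$, $i=1,\dots,n$, $$\sum_{Q\in\mathcal D}K(Q)\prod_{i=1}^n\Bigl|\int_Q f_i\,d\sigma_i\Bigr|\le c_1\prod_{i=1}^n\|f_i\|_{L^{p_i}(\sigma_i)};$$ (b) there is $c_2<\infty$ such that, for all $\phi\in S_n$, $$\Bigl\|\Bigl(\sum_{Q\in\mathcal D}K^\phi_{n-1}(Q)1_Q\Bigr)^{1/r^\phi_{n-1}}\Bigr\|_{L^r(\sigma_{\phi(n)})}\le c_2 .$$ Moreover, if these hold, then there are least possible constants $c_1$ and $c_2$, and they are comparable: $c_1\le C\,c_2$ and $c_2\le C\,c_1$ with a constant $C$ that depends only on $n$ and $p_1,\dots,p_n$. -/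

import Mathlib

open MeasureTheory
open scoped NNReal ENNReal

noncomputable section

namespace DyadicEmbedding

/-- The dyadic cube `2^{-k}(m + [0,1)^d)` of `ℝ^d`. -/
def cube {d : ℕ} (k : ℤ) (m : Fin d → ℤ) : Set (Fin d → ℝ) :=
  {x | ∀ i, (2 : ℝ) ^ (-k) * (m i : ℝ) ≤ x i ∧ x i < (2 : ℝ) ^ (-k) * ((m i : ℝ) + 1)}

/-- The family of all dyadic cubes of `ℝ^d`, as a family of sets. -/
abbrev DyadicCube (d : ℕ) : Type :=
  {Q : Set (Fin d → ℝ) // ∃ (k : ℤ) (m : Fin d → ℤ), Q = cube k m}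

/-- The `n`-linear dyadic embedding with constant `c`:
`∑_Q K(Q) ∏_i |∫_Q f_i dσ_i| ≤ c ∏_i ‖f_i‖_{L^{p_i}(σ_i)}` for all `f_i ∈ L^{p_i}(σ_i)`. -/
def Embedding {n d : ℕ} (p : Fin n → ℝ) (K : DyadicCube d → ℝ≥0)
    (σ : Fin n → Measure (Fin d → ℝ)) (c : ℝ≥0) : Prop :=
  ∀ f : Fin n → (Fin d → ℝ) → ℝ,
    (∀ i, MemLp (f i) (ENNReal.ofReal (p i)) (σ i)) →
      ∑' Q : DyadicCube d, (K Q : ℝ≥0∞) * ∏ i, ‖∫ x in (Q : Set (Fin d → ℝ)), f i x ∂(σ i)‖ₑ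
        ≤ (c : ℝ≥0∞) * ∏ i, eLpNorm (f i) (ENNReal.ofReal (p i)) (σ i)

/-- The exponent `r^φ_j`, given by `1 / r^φ_j + ∑_{i=1}^{j} 1 / p_{φ(i)} = 1`. The indices
`1, …, n` are represented by `0, …, n - 1` in `Fin n`. Thus `r^φ_0 = 1`, and `r^φ_n` is the
exponent `r` (which does not depend on `φ`). -/
def rExp {n : ℕ} (p : Fin n → ℝ) (φ : Equiv.Perm (Fin n)) (j : ℕ) : ℝ :=
  (1 - ∑ i ∈ Finset.univ.filter (fun i : Fin n => (i : ℕ) < j), 1 / p (φ i))⁻¹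

/-- The iterated kernels `K^φ_j`: `K^φ_0 = K` and
`K^φ_j(Q) = K^φ_{j-1}(Q) σ_{φ(j)}(Q)
  (σ_{φ(j)}(Q)⁻¹ ∑_{Q' ⊆ Q} K^φ_{j-1}(Q') ∏_{i=j}^{n} σ_{φ(i)}(Q'))^{r^φ_j / r^φ_{j-1} - 1}`.
The values are in `[0,∞]`; a cube with `σ_{φ(j)}(Q) = 0` has `K^φ_j(Q) = 0`.
In the code `j + 1` plays the role of `j`, and the `(j+1)`-st measure is `σ (φ ⟨j, _⟩)`. -/
def kernel {n d : ℕ} (p : Fin n → ℝ) (K : DyadicCube d → ℝ≥0)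
    (σ : Fin n → Measure (Fin d → ℝ)) (φ : Equiv.Perm (Fin n)) :
    (j : ℕ) → j ≤ n → DyadicCube d → ℝ≥0∞
  | 0, _, Q => (K Q : ℝ≥0∞)
  | j + 1, hj, Q =>
      kernel p K σ φ j (Nat.le_of_succ_le hj) Q * σ (φ ⟨j, hj⟩) Q *
        ((σ (φ ⟨j, hj⟩) Q)⁻¹ *
          ∑' Q' : {Q' : DyadicCube d // (Q' : Set (Fin d → ℝ)) ⊆ Q},
            kernel p K σ φ j (Nat.le_of_succ_le hj) Q'.1 *
              ∏ i ∈ Finset.univ.filter (fun i : Fin n => j ≤ (i : ℕ)), σ (φ i) Q'.1)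
          ^ (rExp p φ (j + 1) / rExp p φ j - 1)

/-- The multinonlinear Wolff potential condition with constant `c`: for every permutation `φ`,
`‖(∑_Q K^φ_{n-1}(Q) 1_Q)^{1 / r^φ_{n-1}}‖_{L^r(σ_{φ(n)})} ≤ c`. -/
def WolffBound {n d : ℕ} (hn : 0 < n) (p : Fin n → ℝ) (K : DyadicCube d → ℝ≥0)
    (σ : Fin n → Measure (Fin d → ℝ)) (c : ℝ≥0) : Prop :=
  ∀ φ : Equiv.Perm (Fin n),
    eLpNorm
      (fun x : Fin d → ℝ =>
        (∑' Q : DyadicCube d, (Q : Set (Fin d → ℝ)).indicator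
          (fun _ => kernel p K σ φ (n - 1) (Nat.sub_le n 1) Q) x) ^ (1 / rExp p φ (n - 1)))
      (ENNReal.ofReal (rExp p φ n))
      (σ (φ ⟨n - 1, Nat.sub_lt hn Nat.one_pos⟩)) ≤ (c : ℝ≥0∞)

end DyadicEmbedding

end

/-!
The proof goes by eliminating one measure at a time. Given an embedding with kernel `K` for the
measures `σ_i`, `i ∈ t`, and exponents `P_i` with `∑ 1 / P_i < 1`, eliminating `σ_i` replaces `K` by
the transformed kernel (`stepKernel`) with `q = P_i'` and the remaining exponents by `P_j / q`.
Iterating this in the order of a permutation `φ` produces exactly the kernels `K^φ_j`, and the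
exponents at stage `j` are `p_i / r^φ_j`. Two estimates relate consecutive stages.

* `PosEmbedding.eliminate`: the embedding implies each embedding with one measure eliminated. By
  duality in the function that is paired with `σ_i`, the embedding bounds the `L^q(σ_i)` norm of a
  potential `∑_Q a_Q 1_Q`, and that norm bounds the discrete Wolff sum
  `∑_Q a_Q σ_i(Q) A(Q)^(q-1)`, where `A(Q)` is the average over `Q` of `∑_{R ⊆ Q} a_R 1_R`
  (`tsum_mul_avgSum_rpow_le`). Testing on powers of maximal functions takes the other functions out
  of the inner sum.
* `PosEmbedding.of_eliminate`: the embedding follows from all the embeddings with one measure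
  eliminated. The averages of the functions are replaced by quantities `u_i(Q)` that grow as `Q`
  shrinks, and each `u_i` is written as the sum of its nonnegative increments over the cubes
  containing `Q` (`NestedFamily.exists_increments`). In the expanded product, the smallest of the
  cubes that carry the increments belongs to some index `i` (`prod_sum_le_of_chain`); this takes the
  place of parallel stopping cubes. The part belonging to `i` is estimated by Hölder's inequality
  with exponents `P_i` and `q`, the maximal inequality, and the converse bound of the norm of a
  potential by its Wolff sum (`lintegral_potential_rpow_le`, applied in `sum_increments_mul_le`).

After all measures are eliminated, the embedding says that `∑_Q K^φ_n(Q)` is bounded, and by the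
comparison of potentials with Wolff sums this is the condition on the `L^r` norm
(`eLpNorm_kernel_comparable`). In the converse direction every remaining index must be allowed as
the next one to be eliminated, which is why all permutations enter.

Of the dyadic cubes only the nestedness and the finite measure are used, so the analysis is done for
countable nested families of measurable sets (`NestedFamily`).
-/

namespace DyadicEmbedding

/-! ### Finite chains -/

theorem exists_top_of_total {ι : Type*} {r : ι → ι → Prop}
    (htr : ∀ a b c, r a b → r b c → r a c) (t : Finset ι) (ht : t.Nonempty)
    (htot : ∀ i ∈ t, ∀ j ∈ t, r i j ∨ r j i) : ∃ i ∈ t, ∀ j ∈ t, r j i := by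
  classical
  induction ht using Finset.Nonempty.cons_induction with
  | singleton a =>
    refine ⟨a, by simp, ?_⟩
    have := htot a (by simp) a (by simp)
    simpa using this
  | cons a u ha hu ih =>
    obtain ⟨i, hi, hmax⟩ := ih fun i hi j hj =>
      htot i (Finset.mem_cons_of_mem hi) j (Finset.mem_cons_of_mem hj)
    have haa : r a a := by simpa using htot a (by simp) a (by simp)
    rcases htot a (by simp) i (Finset.mem_cons_of_mem hi) with h | h
    · refine ⟨i, Finset.mem_cons_of_mem hi, fun j hj => ?_⟩
      rcases Finset.mem_cons.1 hj with rfl | hj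
      · exact h
      · exact hmax j hj
    · refine ⟨a, by simp, fun j hj => ?_⟩
      rcases Finset.mem_cons.1 hj with rfl | hj
      · exact haa
      · exact htr _ _ _ (hmax j hj) h

/-- Induction over a finite totally preordered set that adds its elements in increasing order. -/
theorem chain_induction {ι : Type*} [DecidableEq ι] {r : ι → ι → Prop}
    (htr : ∀ a b c, r a b → r b c → r a c) {motive : Finset ι → Prop} (h0 : motive ∅)
    (hstep : ∀ i u, i ∉ u → (∀ j ∈ insert i u, r j i) → motive u → motive (insert i u))
    (t : Finset ι) (htot : ∀ i ∈ t, ∀ j ∈ t, r i j ∨ r j i) : motive t := by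
  induction t using Finset.strongInduction with
  | H t ih =>
    rcases t.eq_empty_or_nonempty with rfl | hne
    · exact h0
    · obtain ⟨i, hi, hmax⟩ := exists_top_of_total htr t hne htot
      have h := hstep i (t.erase i) (Finset.notMem_erase i t)
        (by rw [Finset.insert_erase hi]; exact hmax)
        (ih _ (Finset.erase_ssubset hi) fun a ha b hb =>
          htot a (Finset.mem_of_mem_erase ha) b (Finset.mem_of_mem_erase hb))
      rwa [Finset.insert_erase hi] at h

/-- The mean value bound for `x ↦ x ^ q`, valid throughout `[0, ∞]`. -/
theorem add_rpow_le_rpow_add {q : ℝ} (hq : 1 ≤ q) (y a : ℝ≥0∞) :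
    (y + a) ^ q ≤ y ^ q + ENNReal.ofReal q * (a * (y + a) ^ (q - 1)) := by
  have hq0 : 0 < q := by linarith
  by_cases hy : y = ∞
  · simp [hy, ENNReal.top_rpow_of_pos hq0]
  by_cases ha : a = ∞
  · subst ha
    have h1 : (∞ : ℝ≥0∞) ^ (q - 1) ≠ 0 := by
      rcases hq.eq_or_lt with h | h
      · simp [← h]
      · simp [ENNReal.top_rpow_of_pos (sub_pos.2 h)]
    have : ENNReal.ofReal q * (∞ * (y + ∞) ^ (q - 1)) = ∞ := by
      rw [add_top, ENNReal.top_mul h1, ENNReal.mul_top]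
      simpa using hq0
    rw [this]
    simp
  lift y to ℝ≥0 using hy
  lift a to ℝ≥0 using ha
  by_cases hz : y + a = 0
  · have : (y : ℝ≥0∞) + a = 0 := by exact_mod_cast hz
    rw [this, ENNReal.zero_rpow_of_pos hq0]
    exact zero_le
  have hx : (0 : ℝ) < (y + a : ℝ) := by
    have : 0 < y + a := pos_iff_ne_zero.2 hz
    exact_mod_cast this
  have hyx : (y : ℝ) / (y + a) = 1 + -((a : ℝ) / (y + a)) := by field_simp; ring
  have hB := one_add_mul_self_le_rpow_one_add (s := -((a : ℝ) / (y + a)))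
    (by
      rw [neg_le_neg_iff, div_le_one hx]
      have := y.2
      simp) hq
  rw [← hyx, Real.div_rpow (NNReal.coe_nonneg y) hx.le] at hB
  have hxq : 0 < ((y : ℝ) + a) ^ q := Real.rpow_pos_of_pos hx q
  rw [le_div_iff₀ hxq] at hB
  have hsub : ((y : ℝ) + a) ^ (q - 1) = (y + a : ℝ) ^ q / (y + a) := by
    rw [Real.rpow_sub hx, Real.rpow_one]
  have key : ((y : ℝ) + a) ^ q ≤ (y : ℝ) ^ q + q * (a * ((y : ℝ) + a) ^ (q - 1)) := by
    rw [hsub]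
    have : (1 + q * -((a : ℝ) / (y + a))) * ((y : ℝ) + a) ^ q
        = ((y : ℝ) + a) ^ q - q * (a * ((y + a : ℝ) ^ q / (y + a))) := by
      field_simp
      ring
    linarith
  have key' : (y + a) ^ q ≤ y ^ q + q.toNNReal * (a * (y + a) ^ (q - 1)) := by
    rw [← NNReal.coe_le_coe]
    push_cast
    rw [Real.coe_toNNReal q hq0.le]
    exact key
  rw [ENNReal.ofReal]
  have h1 : ((y : ℝ≥0∞) + a) ^ (q - 1) = (((y + a) ^ (q - 1) : ℝ≥0) : ℝ≥0∞) := by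
    rw [← ENNReal.coe_add, ENNReal.coe_rpow_of_nonneg _ (by linarith)]
  rw [h1, ← ENNReal.coe_add, ← ENNReal.coe_rpow_of_nonneg _ hq0.le,
    ← ENNReal.coe_rpow_of_nonneg _ hq0.le]
  exact_mod_cast key'

/-- Summation by parts for a power along a chain: the increments of `x ↦ x ^ q` at the partial
sums are controlled by the mean value bound. -/
theorem sum_rpow_le_of_chain {ι : Type*} {r : ι → ι → Prop} [DecidableRel r]
    (htr : ∀ a b c, r a b → r b c → r a c) {q : ℝ} (hq : 1 ≤ q) (a : ι → ℝ≥0∞)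
    (t : Finset ι) (htot : ∀ i ∈ t, ∀ j ∈ t, r i j ∨ r j i) :
    (∑ i ∈ t, a i) ^ q ≤
      ENNReal.ofReal q * ∑ i ∈ t, a i * (∑ j ∈ t.filter (fun j => r j i), a j) ^ (q - 1) := by
  classical
  refine chain_induction htr (motive := fun t => (∑ i ∈ t, a i) ^ q ≤
      ENNReal.ofReal q * ∑ i ∈ t, a i * (∑ j ∈ t.filter (fun j => r j i), a j) ^ (q - 1))
      ?_ ?_ t htot
  · simp [ENNReal.zero_rpow_of_pos (by linarith : 0 < q)]
  · intro i u hi hmax ih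
    rw [Finset.sum_insert hi, Finset.sum_insert hi, Finset.filter_true_of_mem hmax,
      Finset.sum_insert hi, add_comm (a i), mul_add, add_comm (ENNReal.ofReal q * _)]
    refine (add_rpow_le_rpow_add hq _ _).trans (add_le_add (ih.trans ?_) le_rfl)
    gcongr with j hj
    exact Finset.subset_insert _ _

theorem prod_add_le {κ : Type*} [DecidableEq κ] (T : Finset κ) (y d : κ → ℝ≥0∞) :
    ∏ k ∈ T, (y k + d k) ≤
      ∏ k ∈ T, y k + ∑ k ∈ T, d k * ∏ l ∈ T.erase k, (y l + d l) := by
  induction T using Finset.induction_on with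
  | empty => simp
  | insert a u ha ih =>
    rw [Finset.prod_insert ha, Finset.prod_insert ha, Finset.sum_insert ha,
      Finset.erase_insert ha]
    have h : ∑ k ∈ u, d k * ∏ l ∈ (insert a u).erase k, (y l + d l)
        = (y a + d a) * ∑ k ∈ u, d k * ∏ l ∈ u.erase k, (y l + d l) := by
      rw [Finset.mul_sum]
      refine Finset.sum_congr rfl fun k hk => ?_
      have hka : a ≠ k := fun h => ha (h ▸ hk)
      rw [Finset.erase_insert_of_ne hka,
        Finset.prod_insert fun h => ha (Finset.mem_of_mem_erase h)]
      ring
    rw [h]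
    calc (y a + d a) * ∏ k ∈ u, (y k + d k)
        = y a * ∏ k ∈ u, (y k + d k) + d a * ∏ k ∈ u, (y k + d k) := by ring
      _ ≤ y a * (∏ k ∈ u, y k + ∑ k ∈ u, d k * ∏ l ∈ u.erase k, (y l + d l))
          + d a * ∏ k ∈ u, (y k + d k) := by gcongr
      _ ≤ y a * ∏ k ∈ u, y k + (y a + d a) * (∑ k ∈ u, d k * ∏ l ∈ u.erase k, (y l + d l))
          + d a * ∏ k ∈ u, (y k + d k) := by
          rw [mul_add]
          gcongr
          exact le_self_add
      _ = _ := by ring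

/-- The discrete product rule along a chain: among the indices `R_k` in the expansion of
`∏ k, ∑ R, d k R`, single out the greatest. -/
theorem prod_sum_le_of_chain {ι κ : Type*} [DecidableEq κ] {r : ι → ι → Prop} [DecidableRel r]
    (htr : ∀ a b c, r a b → r b c → r a c) (T : Finset κ) (hT : T.Nonempty)
    (d : κ → ι → ℝ≥0∞) (t : Finset ι) (htot : ∀ i ∈ t, ∀ j ∈ t, r i j ∨ r j i) :
    ∏ k ∈ T, ∑ i ∈ t, d k i ≤
      ∑ i ∈ t, ∑ k ∈ T, d k i * ∏ l ∈ T.erase k, ∑ j ∈ t.filter (fun j => r j i), d l j := by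
  classical
  refine chain_induction htr (motive := fun t => ∏ k ∈ T, ∑ i ∈ t, d k i ≤
      ∑ i ∈ t, ∑ k ∈ T, d k i * ∏ l ∈ T.erase k, ∑ j ∈ t.filter (fun j => r j i), d l j)
      ?_ ?_ t htot
  · simp [Finset.prod_const, hT.card_pos.ne']
  · intro i u hi hmax ih
    rw [Finset.sum_insert hi, Finset.filter_true_of_mem hmax]
    simp only [Finset.sum_insert hi]
    simp only [add_comm (d _ i) (∑ i ∈ u, _)]
    refine (prod_add_le T _ _).trans ?_
    rw [add_comm]
    gcongr
    refine ih.trans ?_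
    gcongr
    exact Finset.subset_insert _ _

/-! ### Nested families of sets -/

/-- A family of nonempty measurable sets, any two of which are disjoint or nested, indexed without
repetition. Besides countability, this is all that is used of the dyadic cubes. -/
structure NestedFamily {X ι : Type*} [MeasurableSpace X] (s : ι → Set X) : Prop where
  injective : Function.Injective s
  nonempty : ∀ Q, (s Q).Nonempty
  measurable : ∀ Q, MeasurableSet (s Q)
  nested : ∀ Q R, (s Q ∩ s R).Nonempty → s Q ⊆ s R ∨ s R ⊆ s Q

/-- Induction over a finite subfamily that adds a minimal set at each step. -/
theorem NestedFamily.finset_induction {X ι : Type*} [MeasurableSpace X] [DecidableEq ι]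
    {s : ι → Set X} (hs : NestedFamily s) {motive : Finset ι → Prop} (h0 : motive ∅)
    (hstep : ∀ Q u, Q ∉ u → (∀ R ∈ u, (s Q ∩ s R).Nonempty → s Q ⊆ s R) →
      motive u → motive (insert Q u)) (t : Finset ι) : motive t := by
  induction t using Finset.strongInduction with
  | H t ih =>
    rcases t.eq_empty_or_nonempty with rfl | hne
    · exact h0
    · obtain ⟨Q, hQ, hmin⟩ := t.exists_minimalFor s hne
      have h := hstep Q (t.erase Q) (Finset.notMem_erase Q t)
        (fun R hR hQR => (hs.nested Q R hQR).elim id fun h =>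
          hmin (Finset.mem_of_mem_erase hR) h)
        (ih _ (Finset.erase_ssubset hQ))
      rwa [Finset.insert_erase hQ] at h

open Classical in
/-- A function on a nested family that grows as the sets shrink is, on a finite subfamily, the sum
of nonnegative increments over the members above; the sums never exceed the function. -/
theorem NestedFamily.exists_increments {X ι : Type*} [MeasurableSpace X] {s : ι → Set X}
    (hs : NestedFamily s) (v : ι → ℝ≥0∞) (hv : ∀ Q R, s Q ⊆ s R → v R ≤ v Q) (F : Finset ι) :
    ∃ d : ι → ℝ≥0∞, (∀ Q ∈ F, ∑ R ∈ F.filter (fun R => s Q ⊆ s R), d R = v Q) ∧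
      ∀ Q, ∑ R ∈ F.filter (fun R => s Q ⊆ s R), d R ≤ v Q := by
  refine hs.finset_induction (motive := fun F => ∃ d : ι → ℝ≥0∞,
    (∀ Q ∈ F, ∑ R ∈ F.filter (fun R => s Q ⊆ s R), d R = v Q) ∧
      ∀ Q, ∑ R ∈ F.filter (fun R => s Q ⊆ s R), d R ≤ v Q) ⟨0, by simp⟩ ?_ F
  rintro Q₀ u hQ₀ hmin ⟨d, hd, hd'⟩
  have hagree : ∀ Q, ∀ e : ℝ≥0∞,
      ∑ R ∈ u.filter (fun R => s Q ⊆ s R), Function.update d Q₀ e R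
        = ∑ R ∈ u.filter (fun R => s Q ⊆ s R), d R := fun Q e =>
    Finset.sum_congr rfl fun R hR => Function.update_of_ne
      (fun h : R = Q₀ => hQ₀ (h ▸ (Finset.mem_filter.1 hR).1)) _ _
  set e : ℝ≥0∞ := v Q₀ - ∑ R ∈ u.filter (fun R => s Q₀ ⊆ s R), d R with he
  have hself : ∑ R ∈ (insert Q₀ u).filter (fun R => s Q₀ ⊆ s R), Function.update d Q₀ e R
      = v Q₀ := by
    rw [Finset.filter_insert, if_pos subset_rfl, Finset.sum_insert (by simp [hQ₀]), hagree,
      Function.update_self, he, tsub_add_cancel_of_le (hd' Q₀)]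
  have hother : ∀ Q, ¬ s Q ⊆ s Q₀ →
      ∑ R ∈ (insert Q₀ u).filter (fun R => s Q ⊆ s R), Function.update d Q₀ e R
        = ∑ R ∈ u.filter (fun R => s Q ⊆ s R), d R := fun Q hQ => by
    rw [Finset.filter_insert, if_neg hQ, hagree]
  refine ⟨Function.update d Q₀ e, fun Q hQ => ?_, fun Q => ?_⟩
  · rcases Finset.mem_insert.1 hQ with rfl | hQu
    · exact hself
    · rw [hother Q fun h => ?_, hd Q hQu]
      have h' := hmin Q hQu (by rw [Set.inter_eq_right.2 h]; exact hs.nonempty Q)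
      exact hQ₀ (hs.injective (h.antisymm h') ▸ hQu)
  · by_cases hQ : s Q ⊆ s Q₀
    · refine le_of_eq_of_le ?_ (hself.le.trans (hv _ _ hQ))
      congr 1
      ext R
      simp only [Finset.mem_filter, Finset.mem_insert, and_congr_right_iff]
      rintro (rfl | hR)
      · simp [hQ]
      · refine ⟨fun h => hmin R hR ?_, hQ.trans⟩
        obtain ⟨x, hx⟩ := hs.nonempty Q
        exact ⟨x, hQ hx, h hx⟩
    · rw [hother Q hQ]
      exact hd' Q

/-! ### The maximal function -/

section Maximal

variable {X ι : Type*} [MeasurableSpace X]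

/-- The maximal function of `f` over the family `s`, with respect to the measure `μ`. A set of
measure zero contributes `0`, because `∞ * 0 = 0`. -/
noncomputable def maxFn (s : ι → Set X) (μ : Measure X) (f : X → ℝ≥0∞) (x : X) : ℝ≥0∞ :=
  ⨆ Q, (s Q).indicator (fun _ => (μ (s Q))⁻¹ * ∫⁻ y in s Q, f y ∂μ) x

/-- The maximal function over a finite subfamily. -/
noncomputable def maxFnFinset (s : ι → Set X) (μ : Measure X) (F : Finset ι) (f : X → ℝ≥0∞) (x : X) : ℝ≥0∞ :=
  F.sup fun Q => (s Q).indicator (fun _ => (μ (s Q))⁻¹ * ∫⁻ y in s Q, f y ∂μ) x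

variable {s : ι → Set X} {μ : Measure X} {f : X → ℝ≥0∞}

theorem measurable_maxFn [Countable ι] (hs : NestedFamily s) : Measurable (maxFn s μ f) :=
  Measurable.iSup fun Q => measurable_const.indicator (hs.measurable Q)

theorem measurable_maxFnFinset (hs : NestedFamily s) (F : Finset ι) :
    Measurable (maxFnFinset s μ F f) := by
  unfold maxFnFinset
  simp_rw [Finset.sup_eq_iSup]
  exact Measurable.biSup (F : Set ι) F.countable_toSet fun Q _ =>
    measurable_const.indicator (hs.measurable Q)

theorem average_le_maxFn {Q : ι} {x : X} (hx : x ∈ s Q) :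
    (μ (s Q))⁻¹ * ∫⁻ y in s Q, f y ∂μ ≤ maxFn s μ f x := by
  refine le_trans ?_ (le_iSup _ Q)
  rw [Set.indicator_of_mem hx]

theorem measure_biUnion_le_of_nested (hs : NestedFamily s) (ν : Measure X) (t : ℝ≥0∞)
    (F : Finset ι) (h : ∀ Q ∈ F, t * μ (s Q) ≤ ν (s Q)) :
    t * μ (⋃ Q ∈ F, s Q) ≤ ν (⋃ Q ∈ F, s Q) := by
  classical
  refine hs.finset_induction (motive := fun F => (∀ Q ∈ F, t * μ (s Q) ≤ ν (s Q)) →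
    t * μ (⋃ Q ∈ F, s Q) ≤ ν (⋃ Q ∈ F, s Q)) (by simp) ?_ F h
  intro Q u _ hmin ih hQu
  have ih' := ih fun R hR => hQu R (Finset.mem_insert_of_mem hR)
  rw [Finset.set_biUnion_insert]
  by_cases hex : ∃ R ∈ u, (s Q ∩ s R).Nonempty
  · obtain ⟨R, hR, hQR⟩ := hex
    have : s Q ⊆ ⋃ R ∈ u, s R := (hmin R hR hQR).trans (Set.subset_biUnion_of_mem hR)
    rwa [Set.union_eq_right.2 this]
  · have hdisj : Disjoint (s Q) (⋃ R ∈ u, s R) := by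
      simp only [Set.disjoint_iUnion_right]
      intro R hR
      by_contra hcon
      exact hex ⟨R, hR, Set.not_disjoint_iff_nonempty_inter.1 hcon⟩
    have hmeas : MeasurableSet (⋃ R ∈ u, s R) :=
      u.measurableSet_biUnion fun R _ => hs.measurable R
    rw [measure_union hdisj hmeas, measure_union hdisj hmeas, mul_add]
    exact add_le_add (hQu Q (Finset.mem_insert_self _ _)) ih'

theorem mul_measure_lt_maxFnFinset_le (hs : NestedFamily s) (F : Finset ι) (t : ℝ≥0∞) :
    t * μ {x | t < maxFnFinset s μ F f x}
      ≤ μ.withDensity f {x | t < maxFnFinset s μ F f x} := by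
  classical
  have hset : {x | t < maxFnFinset s μ F f x}
      = ⋃ Q ∈ F.filter (fun Q => t < (μ (s Q))⁻¹ * ∫⁻ y in s Q, f y ∂μ), s Q := by
    ext x
    simp only [maxFnFinset, Set.mem_ofPred_eq, Finset.lt_sup_iff, Set.mem_iUnion,
      Finset.mem_filter, exists_prop]
    constructor
    · rintro ⟨Q, hQ, hlt⟩
      by_cases hx : x ∈ s Q
      · rw [Set.indicator_of_mem hx] at hlt
        exact ⟨Q, ⟨hQ, hlt⟩, hx⟩
      · rw [Set.indicator_of_notMem hx] at hlt
        exact absurd hlt not_lt_zero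
    · rintro ⟨Q, ⟨hQ, hlt⟩, hx⟩
      exact ⟨Q, hQ, by rwa [Set.indicator_of_mem hx]⟩
  rw [hset]
  refine measure_biUnion_le_of_nested hs _ t _ fun Q hQ => ?_
  rw [withDensity_apply _ (hs.measurable Q)]
  have hlt := (Finset.mem_filter.1 hQ).2
  calc t * μ (s Q) ≤ ((μ (s Q))⁻¹ * ∫⁻ y in s Q, f y ∂μ) * μ (s Q) := by gcongr
    _ = ((μ (s Q))⁻¹ * μ (s Q)) * ∫⁻ y in s Q, f y ∂μ := by ring
    _ ≤ 1 * ∫⁻ y in s Q, f y ∂μ := by gcongr; exact ENNReal.inv_mul_le_one _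
    _ = _ := one_mul _

theorem average_ne_top {p : ℝ} (hp : 1 < p) (hf : AEMeasurable f μ) (hfin : ∀ Q, μ (s Q) ≠ ∞)
    (hfp : ∫⁻ x, f x ^ p ∂μ ≠ ∞) (Q : ι) : (μ (s Q))⁻¹ * ∫⁻ y in s Q, f y ∂μ ≠ ∞ := by
  by_cases h0 : μ (s Q) = 0
  · simp [Measure.restrict_eq_zero.2 h0]
  have hH := ENNReal.lintegral_mul_le_Lp_mul_Lq (μ.restrict (s Q))
    (Real.HolderConjugate.conjExponent hp) hf.restrict (aemeasurable_const (b := (1 : ℝ≥0∞)))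
  refine ENNReal.mul_ne_top (ENNReal.inv_ne_top.2 h0) (ne_top_of_le_ne_top ?_
    ((le_of_eq (by simp)).trans hH))
  refine ENNReal.mul_ne_top (ENNReal.rpow_ne_top_of_nonneg (by positivity)
    (ne_top_of_le_ne_top hfp (lintegral_mono' Measure.restrict_le_self le_rfl))) ?_
  refine ENNReal.rpow_ne_top_of_nonneg ?_ (by simpa using hfin Q)
  have := (Real.HolderConjugate.conjExponent hp).symm.pos
  positivity

theorem maxFnFinset_ne_top {p : ℝ} (hp : 1 < p) (hf : AEMeasurable f μ)
    (hfin : ∀ Q, μ (s Q) ≠ ∞) (hfp : ∫⁻ x, f x ^ p ∂μ ≠ ∞) (F : Finset ι) (x : X) :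
    maxFnFinset s μ F f x ≠ ∞ := by
  unfold maxFnFinset
  rw [← lt_top_iff_ne_top, Finset.sup_lt_iff (by simp)]
  intro Q _
  refine lt_of_le_of_lt (Set.indicator_le_self' (fun _ _ => zero_le) x) ?_
  exact (average_ne_top hp hf hfin hfp Q).lt_top

theorem lintegral_maxFnFinset_rpow_ne_top (hs : NestedFamily s) {p : ℝ} (hp : 1 < p)
    (hf : AEMeasurable f μ) (hfin : ∀ Q, μ (s Q) ≠ ∞) (hfp : ∫⁻ x, f x ^ p ∂μ ≠ ∞)
    (F : Finset ι) : ∫⁻ x, maxFnFinset s μ F f x ^ p ∂μ ≠ ∞ := by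
  have hp0 : 0 < p := by linarith
  set A : ι → ℝ≥0∞ := fun Q => (μ (s Q))⁻¹ * ∫⁻ y in s Q, f y ∂μ with hA
  have hb : ∀ x, maxFnFinset s μ F f x ^ p
      ≤ ∑ Q ∈ F, (s Q).indicator (fun _ => A Q ^ p) x := fun x => by
    have h1 : maxFnFinset s μ F f x ^ p ≤ F.sup fun Q => (s Q).indicator (fun _ => A Q ^ p) x := by
      unfold maxFnFinset
      rcases F.eq_empty_or_nonempty with rfl | hne
      · simp [hp0]
      obtain ⟨Q, hQ, h⟩ := Finset.exists_mem_eq_sup F hne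
        fun Q => (s Q).indicator (fun _ => A Q) x
      rw [h]
      refine le_trans (le_of_eq ?_)
        (Finset.le_sup (f := fun Q => (s Q).indicator (fun _ => A Q ^ p) x) hQ)
      by_cases hx : x ∈ s Q <;> simp [hx, hp0]
    refine h1.trans (Finset.sup_le fun Q hQ => ?_)
    exact Finset.single_le_sum (f := fun Q => (s Q).indicator (fun _ => A Q ^ p) x)
      (fun _ _ => zero_le) hQ
  refine ne_top_of_le_ne_top ?_ (lintegral_mono hb)
  rw [lintegral_finsetSum _ fun Q _ => measurable_const.indicator (hs.measurable Q)]
  refine ENNReal.sum_ne_top.2 fun Q _ => ?_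
  rw [lintegral_indicator_const (hs.measurable Q)]
  exact ENNReal.mul_ne_top (ENNReal.rpow_ne_top_of_nonneg hp0.le
    (average_ne_top hp hf hfin hfp Q)) (hfin Q)

/-- The weak type bound, integrated against `t ^ (p - 2)`: both sides become powers of the maximal
function by the layer cake formula, for `μ` and for the measure `f μ`. -/
theorem lintegral_maxFnFinset_rpow_le (hs : NestedFamily s) {p : ℝ} (hp : 1 < p)
    (hf : Measurable f) (F : Finset ι) (hne : ∀ x, maxFnFinset s μ F f x ≠ ∞) :
    ∫⁻ x, maxFnFinset s μ F f x ^ p ∂μ ≤ ENNReal.ofReal p * (ENNReal.ofReal (p - 1))⁻¹ *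
      ∫⁻ x, f x * maxFnFinset s μ F f x ^ (p - 1) ∂μ := by
  have hp0 : 0 < p := by linarith
  have hp1 : 0 < p - 1 := by linarith
  set m := maxFnFinset s μ F f with hm
  have hmm : Measurable m := measurable_maxFnFinset hs F
  have hconv : ∀ (e : ℝ), 0 < e → ∀ x, ENNReal.ofReal ((m x).toReal ^ e) = m x ^ e := by
    intro e he x
    rw [← ENNReal.ofReal_rpow_of_nonneg ENNReal.toReal_nonneg he.le,
      ENNReal.ofReal_toReal (hne x)]
  have hlev : ∀ t : ℝ, 0 < t → {x | t < (m x).toReal} = {x | ENNReal.ofReal t < m x} := by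
    intro t ht
    ext x
    simp only [Set.mem_ofPred_eq]
    exact (ENNReal.ofReal_lt_iff_lt_toReal ht.le (hne x)).symm
  have h1 := lintegral_rpow_eq_lintegral_meas_lt_mul (μ := μ) (f := fun x => (m x).toReal)
    (Filter.Eventually.of_forall fun x => ENNReal.toReal_nonneg) hmm.ennreal_toReal.aemeasurable hp0
  have h2 := lintegral_rpow_eq_lintegral_meas_lt_mul (μ := μ.withDensity f)
    (f := fun x => (m x).toReal)
    (Filter.Eventually.of_forall fun x => ENNReal.toReal_nonneg) hmm.ennreal_toReal.aemeasurable hp1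
  simp only [hconv p hp0] at h1
  simp only [hconv (p - 1) hp1] at h2
  rw [lintegral_withDensity_eq_lintegral_mul _ hf (by fun_prop)] at h2
  simp only [Pi.mul_apply] at h2
  rw [h1, h2, mul_assoc, ← mul_assoc _ (ENNReal.ofReal (p - 1)),
    ENNReal.inv_mul_cancel (by simpa using hp) ENNReal.ofReal_ne_top, one_mul]
  gcongr ENNReal.ofReal p * ?_
  refine setLIntegral_mono' measurableSet_Ioi fun t ht => ?_
  have ht : 0 < t := ht
  rw [hlev t ht]
  have hsplit : ENNReal.ofReal (t ^ (p - 1)) =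
      ENNReal.ofReal t * ENNReal.ofReal (t ^ (p - 1 - 1)) := by
    rw [← ENNReal.ofReal_mul ht.le]
    congr 1
    rw [Real.rpow_sub_one ht.ne' (p - 1)]
    field_simp
  rw [hsplit, ← mul_assoc, mul_comm (μ _)]
  gcongr
  exact mul_measure_lt_maxFnFinset_le hs F _

theorem rpow_conj_le {p q : ℝ} (hpq : p.HolderConjugate q) {x y : ℝ≥0∞} (hx : x ≠ ∞)
    (h : x ≤ y * x ^ (1 / q)) : x ≤ y ^ p := by
  by_cases hx0 : x = 0
  · simp [hx0]
  have h1 : x = x ^ (1 / p) * x ^ (1 / q) := by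
    rw [← ENNReal.rpow_add _ _ hx0 hx]
    have := hpq.inv_add_inv_eq_one
    rw [one_div, one_div, this, ENNReal.rpow_one]
  have h2 : x ^ (1 / p) ≤ y := by
    nth_rewrite 1 [h1] at h
    refine (ENNReal.mul_le_mul_iff_left ?_ ?_).1 h
    · exact (ENNReal.rpow_pos (pos_iff_ne_zero.2 hx0) hx).ne'
    · exact ENNReal.rpow_ne_top_of_nonneg (by have := hpq.symm.pos; positivity) hx
  calc x = (x ^ (1 / p)) ^ p := by
        rw [← ENNReal.rpow_mul, one_div_mul_cancel hpq.ne_zero, ENNReal.rpow_one]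
    _ ≤ y ^ p := ENNReal.rpow_le_rpow h2 hpq.nonneg

/-- The constant in the maximal inequality on `L ^ p`. -/
noncomputable def maxConst (p : ℝ) : ℝ≥0∞ := (ENNReal.ofReal p * (ENNReal.ofReal (p - 1))⁻¹) ^ p

theorem maxConst_ne_top {p : ℝ} (hp : 1 < p) : maxConst p ≠ ∞ := by
  unfold maxConst
  refine ENNReal.rpow_ne_top_of_nonneg (by linarith)
    (ENNReal.mul_ne_top ENNReal.ofReal_ne_top (ENNReal.inv_ne_top.2 (by simpa using hp)))

theorem iSup_maxFnFinset (x : X) : ⨆ F : Finset ι, maxFnFinset s μ F f x = maxFn s μ f x := by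
  unfold maxFnFinset maxFn
  refine le_antisymm (iSup_le fun F => Finset.sup_le fun Q _ => ?_) (iSup_le fun Q => ?_)
  · exact le_iSup (fun Q => (s Q).indicator (fun _ => (μ (s Q))⁻¹ * ∫⁻ y in s Q, f y ∂μ) x) Q
  · refine le_trans ?_ (le_iSup _ {Q})
    simp

theorem iSup_rpow' {κ : Sort*} (g : κ → ℝ≥0∞) {p : ℝ} (hp : 0 < p) :
    (⨆ k, g k) ^ p = ⨆ k, g k ^ p :=
  (ENNReal.orderIsoRpow p hp).map_iSup g

/-- The maximal inequality on `L ^ p`, for `1 < p`. -/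
theorem lintegral_maxFn_rpow_le [Countable ι] (hs : NestedFamily s) (hfin : ∀ Q, μ (s Q) ≠ ∞)
    {p : ℝ} (hp : 1 < p) (hf : Measurable f) :
    ∫⁻ x, maxFn s μ f x ^ p ∂μ ≤ maxConst p * ∫⁻ x, f x ^ p ∂μ := by
  have hp0 : 0 < p := by linarith
  by_cases hfp : ∫⁻ x, f x ^ p ∂μ = ∞
  · have : maxConst p ≠ 0 := by
      unfold maxConst
      refine (ENNReal.rpow_pos ?_ ?_).ne'
      · exact ENNReal.mul_pos (by simpa using hp0) (by simp)
      · exact ENNReal.mul_ne_top ENNReal.ofReal_ne_top (ENNReal.inv_ne_top.2 (by simpa using hp))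
    rw [hfp, ENNReal.mul_top this]
    exact le_top
  have hpq := Real.HolderConjugate.conjExponent hp
  set q := p.conjExponent with hq
  have hfinite : ∀ F : Finset ι, ∫⁻ x, maxFnFinset s μ F f x ^ p ∂μ
      ≤ maxConst p * ∫⁻ x, f x ^ p ∂μ := by
    intro F
    have hne := maxFnFinset_ne_top (s := s) hp hf.aemeasurable hfin hfp F
    have h1 := lintegral_maxFnFinset_rpow_le hs hp hf F hne
    have h2 := ENNReal.lintegral_mul_le_Lp_mul_Lq μ hpq hf.aemeasurable
      ((measurable_maxFnFinset (μ := μ) (f := f) hs F).pow_const (p - 1)).aemeasurable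
    simp only [Pi.mul_apply, ← ENNReal.rpow_mul, hpq.sub_one_mul_conj] at h2
    have h3 := rpow_conj_le hpq
      (lintegral_maxFnFinset_rpow_ne_top hs hp hf.aemeasurable hfin hfp F)
      (h1.trans ((mul_le_mul_right h2 _).trans_eq (mul_assoc _ _ _).symm))
    refine h3.trans_eq ?_
    rw [ENNReal.mul_rpow_of_nonneg _ _ hp0.le, ← ENNReal.rpow_mul, one_div_mul_cancel hp0.ne',
      ENNReal.rpow_one]
    rfl
  simp_rw [← iSup_maxFnFinset, iSup_rpow' _ hp0]
  rw [lintegral_iSup_directed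
    (fun F => ((measurable_maxFnFinset hs F).pow_const p).aemeasurable)]
  · exact iSup_le hfinite
  · refine Monotone.directed_le fun F G hFG x => ?_
    exact ENNReal.rpow_le_rpow (Finset.sup_mono hFG) hp0.le

end Maximal

/-! ### The norm of a potential as a discrete Wolff sum -/

section Potential

open Classical in
theorem sum_indicator_eq {X ι : Type*} {s : ι → Set X} (a : ι → ℝ≥0∞) (F : Finset ι) (x : X) :
    ∑ Q ∈ F, (s Q).indicator (fun _ => a Q) x = ∑ Q ∈ F.filter (fun Q => x ∈ s Q), a Q := by
  rw [Finset.sum_filter]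
  exact Finset.sum_congr rfl fun Q _ => by simp [Set.indicator_apply]

variable {X ι : Type*} [MeasurableSpace X]

/-- The sum `∑_Q a_Q 1_Q`. -/
noncomputable def potential (s : ι → Set X) (a : ι → ℝ≥0∞) (x : X) : ℝ≥0∞ :=
  ∑' Q, (s Q).indicator (fun _ => a Q) x

/-- The average over `R` of the part `∑_{Q ⊆ R} a_Q 1_Q` of the potential inside `R`; it is `0` if
`R` has measure zero. -/
noncomputable def avgSum (s : ι → Set X) (μ : Measure X) (a : ι → ℝ≥0∞) (R : ι) : ℝ≥0∞ :=
  (μ (s R))⁻¹ * ∑' Q : {Q // s Q ⊆ s R}, a Q * μ (s Q)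

variable {s : ι → Set X} {μ : Measure X}

theorem measurable_potential [Countable ι] (hs : NestedFamily s) (a : ι → ℝ≥0∞) :
    Measurable (potential s a) :=
  Measurable.tsum fun Q => measurable_const.indicator (hs.measurable Q)

theorem lintegral_potential [Countable ι] (hs : NestedFamily s) (a : ι → ℝ≥0∞) :
    ∫⁻ x, potential s a x ∂μ = ∑' Q, a Q * μ (s Q) := by
  unfold potential
  rw [lintegral_tsum fun Q => (measurable_const.indicator (hs.measurable Q)).aemeasurable]
  simp_rw [lintegral_indicator_const (hs.measurable _)]

theorem mul_avgSum (hfin : ∀ Q, μ (s Q) ≠ ∞) (a : ι → ℝ≥0∞) (R : ι) :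
    μ (s R) * avgSum s μ a R = ∑' Q : {Q // s Q ⊆ s R}, a Q * μ (s Q) := by
  unfold avgSum
  by_cases h0 : μ (s R) = 0
  · have : ∀ Q : {Q // s Q ⊆ s R}, a Q * μ (s Q) = 0 := fun Q => by
      rw [measure_mono_null Q.2 h0, mul_zero]
    simp [this]
  · rw [← mul_assoc, ENNReal.mul_inv_cancel h0 (hfin R), one_mul]

theorem avgSum_mono {a b : ι → ℝ≥0∞} (h : ∀ Q, a Q ≤ b Q) (R : ι) :
    avgSum s μ a R ≤ avgSum s μ b R := by
  unfold avgSum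
  gcongr
  exact h _

theorem avgSum_le_average_potential [Countable ι] (hs : NestedFamily s) (a : ι → ℝ≥0∞) (R : ι) :
    avgSum s μ a R ≤ (μ (s R))⁻¹ * ∫⁻ x in s R, potential s a x ∂μ := by
  unfold avgSum
  gcongr
  rw [lintegral_potential hs]
  refine le_trans (le_of_eq (tsum_congr fun Q => ?_))
    (ENNReal.tsum_comp_le_tsum_of_injective Subtype.val_injective
      fun Q => a Q * (μ.restrict (s R)) (s Q))
  rw [Measure.restrict_apply (hs.measurable _), Set.inter_eq_left.2 Q.2]

open Classical in
theorem sum_inside_le (a : ι → ℝ≥0∞) (F : Finset ι) (R : ι) :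
    ∑ Q ∈ F.filter (fun Q => s Q ⊆ s R), a Q * μ (s Q)
      ≤ ∑' Q : {Q // s Q ⊆ s R}, a Q * μ (s Q) := by
  refine le_trans ?_ (tsum_subtype {Q | s Q ⊆ s R} fun Q => a Q * μ (s Q)).ge
  rw [Finset.sum_filter]
  refine le_trans (Finset.sum_le_sum fun Q _ => ?_) (ENNReal.sum_le_tsum F)
  by_cases h : s Q ⊆ s R <;> simp [h]

/-- Jensen's inequality for the concave power `g ↦ g ^ θ` on a set of finite measure. -/
theorem setLIntegral_rpow_le {θ : ℝ} (h0 : 0 < θ) (h1 : θ < 1) {A : Set X} (hA : μ A ≠ ∞)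
    {g : X → ℝ≥0∞} (hg : AEMeasurable g μ) :
    ∫⁻ x in A, g x ^ θ ∂μ ≤ μ A * ((μ A)⁻¹ * ∫⁻ x in A, g x ∂μ) ^ θ := by
  by_cases hA0 : μ A = 0
  · simp [Measure.restrict_eq_zero.2 hA0]
  have hpq : (1 / θ).HolderConjugate (1 / (1 - θ)) := by
    rw [Real.holderConjugate_iff]
    exact ⟨by rw [lt_div_iff₀ h0]; linarith, by simp⟩
  have hH := ENNReal.lintegral_mul_le_Lp_mul_Lq (μ.restrict A) hpq
    (hg.restrict.pow_const θ) (aemeasurable_const (b := (1 : ℝ≥0∞)))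
  simp only [Pi.mul_apply, mul_one, ← ENNReal.rpow_mul, ENNReal.one_rpow, lintegral_const,
    one_mul, Measure.restrict_apply_univ, one_div_one_div, mul_one_div_cancel h0.ne',
    ENNReal.rpow_one] at hH
  refine hH.trans_eq ?_
  rw [ENNReal.mul_rpow_of_nonneg _ _ h0.le, ← mul_assoc, mul_comm]
  congr 1
  rw [← ENNReal.rpow_neg_one, ← ENNReal.rpow_mul]
  nth_rewrite 2 [← ENNReal.rpow_one (μ A)]
  rw [← ENNReal.rpow_add _ _ hA0 hA]
  congr 1
  ring

theorem le_two_mul_of_le_half_add {x y : ℝ≥0∞} (hx : x ≠ ∞) (h : x ≤ 2⁻¹ * x + y) :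
    x ≤ 2 * y := by
  have h2 : x = 2⁻¹ * x + 2⁻¹ * x := by rw [← add_mul, ENNReal.inv_two_add_inv_two, one_mul]
  have h3 : 2⁻¹ * x ≤ y := by
    nth_rewrite 1 [h2] at h
    exact ENNReal.le_of_add_le_add_left (ENNReal.mul_ne_top (by simp) hx) h
  calc x = 2 * (2⁻¹ * x) := by
        rw [← mul_assoc, ENNReal.mul_inv_cancel (by simp) (by simp), one_mul]
    _ ≤ 2 * y := by gcongr

theorem rpow_mul_le_add {q : ℝ} (hq : 2 ≤ q) {ε : ℝ≥0∞} (hε : ε ≠ 0) (hε' : ε ≠ ∞)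
    (T A : ℝ≥0∞) :
    T ^ (q - 2) * A ≤ ε * T ^ (q - 1) + ε⁻¹ ^ (q - 2) * A ^ (q - 1) := by
  have hq2 : 0 ≤ q - 2 := by linarith
  have hpow : ∀ z : ℝ≥0∞, z ^ (q - 1) = z ^ (q - 2) * z := fun z => by
    have : q - 1 = (q - 2) + 1 := by ring
    rw [this, ENNReal.rpow_add_of_nonneg _ _ hq2 zero_le_one, ENNReal.rpow_one]
  rcases le_total A (ε * T) with h | h
  · refine le_trans ?_ le_self_add
    rw [hpow]
    calc T ^ (q - 2) * A ≤ T ^ (q - 2) * (ε * T) := by gcongr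
      _ = _ := by ring
  · refine le_trans ?_ le_add_self
    have hT : T ≤ ε⁻¹ * A := by
      calc T = ε⁻¹ * (ε * T) := by rw [← mul_assoc, ENNReal.inv_mul_cancel hε hε', one_mul]
        _ ≤ _ := by gcongr
    rw [hpow A, ← mul_assoc, ← ENNReal.mul_rpow_of_nonneg _ _ hq2]
    gcongr

/-- The constant in the upper bound of the norm of a potential by its discrete Wolff sum. -/
noncomputable def wolffConst (q : ℝ) : ℝ≥0∞ :=
  ENNReal.ofReal q * max 1 (2 * (ENNReal.ofReal (q - 1) * (2 * ENNReal.ofReal (q - 1)) ^ (q - 2)))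

theorem wolffConst_ne_top {q : ℝ} (hq : 1 < q) : wolffConst q ≠ ∞ := by
  have h0 : (2 * ENNReal.ofReal (q - 1)) ≠ 0 := by simp [hq]
  have h1 : (2 * ENNReal.ofReal (q - 1)) ≠ ∞ := ENNReal.mul_ne_top (by simp) ENNReal.ofReal_ne_top
  unfold wolffConst
  refine ENNReal.mul_ne_top ENNReal.ofReal_ne_top (max_lt (by simp) (lt_top_iff_ne_top.2 ?_)).ne
  exact ENNReal.mul_ne_top (by simp)
    (ENNReal.mul_ne_top ENNReal.ofReal_ne_top (ENNReal.rpow_ne_top_of_ne_zero h0 h1))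

/-- For `q < 2`: sum by parts along the chain of sets containing a point, with the partial sums
over the smaller sets, and apply Jensen's inequality on each set. -/
theorem lintegral_sum_indicator_rpow_le_of_lt_two (hs : NestedFamily s)
    (hfin : ∀ Q, μ (s Q) ≠ ∞) {q : ℝ} (hq : 1 < q) (hq2 : q < 2) (a : ι → ℝ≥0∞) (F : Finset ι) :
    ∫⁻ x, (∑ Q ∈ F, (s Q).indicator (fun _ => a Q) x) ^ q ∂μ
      ≤ ENNReal.ofReal q * ∑' Q, a Q * μ (s Q) * avgSum s μ a Q ^ (q - 1) := by
  classical
  set S : ι → X → ℝ≥0∞ := fun Q x =>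
    ∑ R ∈ F.filter (fun R => s R ⊆ s Q), (s R).indicator (fun _ => a R) x with hS
  have hSm : ∀ Q, Measurable (S Q) := fun Q =>
    Finset.measurable_sum _ fun R _ => measurable_const.indicator (hs.measurable R)
  have hpt : ∀ x, (∑ Q ∈ F, (s Q).indicator (fun _ => a Q) x) ^ q ≤
      ENNReal.ofReal q * ∑ Q ∈ F, (s Q).indicator (fun x => a Q * S Q x ^ (q - 1)) x := by
    intro x
    rw [sum_indicator_eq]
    refine (sum_rpow_le_of_chain (r := fun R Q => s R ⊆ s Q) (fun _ _ _ => Set.Subset.trans)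
      hq.le a (F.filter fun Q => x ∈ s Q) fun Q hQ R hR => hs.nested Q R
        ⟨x, (Finset.mem_filter.1 hQ).2, (Finset.mem_filter.1 hR).2⟩).trans ?_
    gcongr
    rw [Finset.sum_filter]
    refine Finset.sum_le_sum fun Q _ => ?_
    by_cases hx : x ∈ s Q
    · rw [if_pos hx, Set.indicator_of_mem hx, hS]
      simp only
      rw [sum_indicator_eq, Finset.filter_filter, Finset.filter_filter]
      simp only [and_comm]
      exact le_rfl
    · simp [hx]
  refine (lintegral_mono hpt).trans ?_
  rw [lintegral_const_mul _ (Finset.measurable_sum _ fun Q _ =>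
      (((hSm Q).pow_const _).const_mul _).indicator (hs.measurable Q)),
    lintegral_finsetSum _ fun Q _ =>
      (((hSm Q).pow_const _).const_mul _).indicator (hs.measurable Q)]
  gcongr
  refine le_trans (Finset.sum_le_sum fun Q _ => ?_) (ENNReal.sum_le_tsum F)
  rw [lintegral_indicator (hs.measurable Q), lintegral_const_mul _ ((hSm Q).pow_const _),
    mul_assoc]
  gcongr
  refine (setLIntegral_rpow_le (by linarith) (by linarith) (hfin Q)
    (hSm Q).aemeasurable).trans ?_
  gcongr
  unfold avgSum
  gcongr
  refine le_trans (le_of_eq ?_) (sum_inside_le a F Q)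
  rw [hS]
  simp only
  rw [lintegral_finsetSum _ fun R _ => measurable_const.indicator (hs.measurable R)]
  refine Finset.sum_congr rfl fun R hR => ?_
  rw [lintegral_indicator_const (hs.measurable R), Measure.restrict_apply (hs.measurable R),
    Set.inter_eq_left.2 (Finset.mem_filter.1 hR).2]

/-- For `2 ≤ q`: sum by parts twice along chains, with the partial sums `T` over the larger sets,
which are constant on each set. This produces `T ^ (q - 2) * A` with the averages `A`, and Young's
inequality lets the power of `T` be absorbed. -/
theorem lintegral_sum_indicator_rpow_le_of_two_le (hs : NestedFamily s)
    (hfin : ∀ Q, μ (s Q) ≠ ∞) {q : ℝ} (hq2 : 2 ≤ q) (a : ι → ℝ≥0∞) (ha : ∀ Q, a Q ≠ ∞)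
    (F : Finset ι) :
    ∫⁻ x, (∑ Q ∈ F, (s Q).indicator (fun _ => a Q) x) ^ q ∂μ
      ≤ ENNReal.ofReal q * (2 * (ENNReal.ofReal (q - 1) * (2 * ENNReal.ofReal (q - 1)) ^ (q - 2)) *
        ∑' Q, a Q * μ (s Q) * avgSum s μ a Q ^ (q - 1)) := by
  classical
  have hq : 1 < q := by linarith
  set T : ι → ℝ≥0∞ := fun Q => ∑ R ∈ F.filter (fun R => s Q ⊆ s R), a R with hT
  set E := ∑' Q, a Q * μ (s Q) * avgSum s μ a Q ^ (q - 1) with hE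
  have hpt : ∀ x, (∑ Q ∈ F, (s Q).indicator (fun _ => a Q) x) ^ q ≤
      ENNReal.ofReal q * ∑ Q ∈ F, (s Q).indicator (fun _ => a Q * T Q ^ (q - 1)) x := by
    intro x
    rw [sum_indicator_eq]
    refine (sum_rpow_le_of_chain (r := fun R Q => s Q ⊆ s R) (fun _ _ _ h h' => h'.trans h)
      hq.le a (F.filter fun Q => x ∈ s Q) fun Q hQ R hR => (hs.nested Q R
        ⟨x, (Finset.mem_filter.1 hQ).2, (Finset.mem_filter.1 hR).2⟩).symm).trans ?_
    gcongr
    rw [Finset.sum_filter]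
    refine Finset.sum_le_sum fun Q _ => ?_
    by_cases hx : x ∈ s Q
    · rw [if_pos hx, Set.indicator_of_mem hx]
      gcongr
      exact Finset.sum_le_sum_of_subset
        (Finset.filter_subset_filter _ (Finset.filter_subset _ _))
    · simp [hx]
  set Y := ∑ Q ∈ F, a Q * μ (s Q) * T Q ^ (q - 1) with hY
  have hTfin : ∀ Q, T Q ≠ ∞ := fun Q => ENNReal.sum_ne_top.2 fun R _ => ha R
  have hYfin : Y ≠ ∞ := ENNReal.sum_ne_top.2 fun Q _ => ENNReal.mul_ne_top
    (ENNReal.mul_ne_top (ha Q) (hfin Q)) (ENNReal.rpow_ne_top_of_nonneg (by linarith) (hTfin Q))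
  have h1 : ∫⁻ x, (∑ Q ∈ F, (s Q).indicator (fun _ => a Q) x) ^ q ∂μ ≤ ENNReal.ofReal q * Y := by
    refine (lintegral_mono hpt).trans ?_
    rw [lintegral_const_mul _ (Finset.measurable_sum _ fun Q _ =>
        measurable_const.indicator (hs.measurable Q)),
      lintegral_finsetSum _ fun Q _ => measurable_const.indicator (hs.measurable Q)]
    gcongr
    refine Finset.sum_le_sum fun Q _ => ?_
    rw [lintegral_indicator_const (hs.measurable Q)]
    exact le_of_eq (by ring)
  have hTstep : ∀ Q, T Q ^ (q - 1) ≤ ENNReal.ofReal (q - 1) *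
      ∑ R ∈ F.filter (fun R => s Q ⊆ s R), a R * T R ^ (q - 2) := by
    intro Q
    obtain ⟨x, hx⟩ := hs.nonempty Q
    refine (sum_rpow_le_of_chain (r := fun R Q => s Q ⊆ s R) (fun _ _ _ h h' => h'.trans h)
      (by linarith : 1 ≤ q - 1) a (F.filter fun R => s Q ⊆ s R) fun R hR R' hR' =>
        (hs.nested R R' ⟨x, (Finset.mem_filter.1 hR).2 hx,
          (Finset.mem_filter.1 hR').2 hx⟩).symm).trans ?_
    have : q - 1 - 1 = q - 2 := by ring
    rw [this]
    gcongr with R hR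
    exact Finset.sum_le_sum_of_subset
      (Finset.filter_subset_filter _ (Finset.filter_subset _ _))
  set ε : ℝ≥0∞ := (2 * ENNReal.ofReal (q - 1))⁻¹ with hε
  have hq1 : ENNReal.ofReal (q - 1) ≠ 0 := by simpa using hq
  have hd0 : (2 * ENNReal.ofReal (q - 1)) ≠ 0 := by simp [hq]
  have hd1 : (2 * ENNReal.ofReal (q - 1)) ≠ ∞ :=
    ENNReal.mul_ne_top (by simp) ENNReal.ofReal_ne_top
  have hεi : ε⁻¹ = 2 * ENNReal.ofReal (q - 1) := by rw [hε, inv_inv]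
  have hεmul : ENNReal.ofReal (q - 1) * ε = 2⁻¹ := by
    rw [hε, ENNReal.mul_inv (by simp) (by simp), mul_comm, mul_assoc,
      ENNReal.inv_mul_cancel hq1 ENNReal.ofReal_ne_top, mul_one]
  have h2 : Y ≤ ENNReal.ofReal (q - 1) *
      ∑ R ∈ F, a R * μ (s R) * (T R ^ (q - 2) * avgSum s μ a R) := by
    calc Y ≤ ∑ Q ∈ F, a Q * μ (s Q) * (ENNReal.ofReal (q - 1) *
          ∑ R ∈ F.filter (fun R => s Q ⊆ s R), a R * T R ^ (q - 2)) := by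
          refine Finset.sum_le_sum fun Q _ => ?_
          gcongr
          exact hTstep Q
      _ = ENNReal.ofReal (q - 1) * ∑ R ∈ F, (a R * T R ^ (q - 2)) *
          ∑ Q ∈ F.filter (fun Q => s Q ⊆ s R), a Q * μ (s Q) := by
          simp_rw [Finset.sum_filter, Finset.mul_sum]
          rw [Finset.sum_comm]
          refine Finset.sum_congr rfl fun R _ => Finset.sum_congr rfl fun Q _ => ?_
          split_ifs
          · ring
          · simp
      _ ≤ _ := by
          gcongr ENNReal.ofReal (q - 1) * ∑ R ∈ F, ?_ with R hR
          calc a R * T R ^ (q - 2) * ∑ Q ∈ F.filter (fun Q => s Q ⊆ s R), a Q * μ (s Q)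
              ≤ a R * T R ^ (q - 2) * (μ (s R) * avgSum s μ a R) := by
                gcongr
                rw [mul_avgSum hfin]
                exact sum_inside_le a F R
            _ = _ := by ring
  have h3 : Y ≤ 2⁻¹ * Y + ENNReal.ofReal (q - 1) * (ε⁻¹ ^ (q - 2) * E) := by
    refine h2.trans ?_
    rw [← hεmul, mul_assoc, ← mul_add]
    gcongr
    calc ∑ R ∈ F, a R * μ (s R) * (T R ^ (q - 2) * avgSum s μ a R)
        ≤ ∑ R ∈ F, a R * μ (s R) * (ε * T R ^ (q - 1) +
            ε⁻¹ ^ (q - 2) * avgSum s μ a R ^ (q - 1)) := by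
          gcongr with R hR
          exact rpow_mul_le_add hq2 (ENNReal.inv_ne_zero.2 hd1) (ENNReal.inv_ne_top.2 hd0) _ _
      _ = ε * Y + ε⁻¹ ^ (q - 2) *
            ∑ R ∈ F, a R * μ (s R) * avgSum s μ a R ^ (q - 1) := by
          rw [hY, Finset.mul_sum, Finset.mul_sum, ← Finset.sum_add_distrib]
          exact Finset.sum_congr rfl fun R _ => by ring
      _ ≤ _ := by
          gcongr
          exact ENNReal.sum_le_tsum F
  have h4 := le_two_mul_of_le_half_add hYfin h3
  refine h1.trans ?_
  gcongr
  refine h4.trans_eq ?_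
  rw [hεi]
  ring

theorem lintegral_sum_indicator_rpow_le (hs : NestedFamily s)
    (hfin : ∀ Q, μ (s Q) ≠ ∞) {q : ℝ} (hq : 1 < q) (a : ι → ℝ≥0∞) (ha : ∀ Q, a Q ≠ ∞)
    (F : Finset ι) :
    ∫⁻ x, (∑ Q ∈ F, (s Q).indicator (fun _ => a Q) x) ^ q ∂μ
      ≤ wolffConst q * ∑' Q, a Q * μ (s Q) * avgSum s μ a Q ^ (q - 1) := by
  unfold wolffConst
  rw [mul_assoc]
  rcases lt_or_ge q 2 with h | h
  · refine (lintegral_sum_indicator_rpow_le_of_lt_two hs hfin hq h a F).trans ?_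
    gcongr
    exact le_mul_of_one_le_left zero_le (le_max_left _ _)
  · refine (lintegral_sum_indicator_rpow_le_of_two_le hs hfin h a ha F).trans ?_
    gcongr
    exact le_max_right _ _

/-- The norm of a potential is controlled by its discrete Wolff sum. -/
theorem lintegral_potential_rpow_le [Countable ι] (hs : NestedFamily s)
    (hfin : ∀ Q, μ (s Q) ≠ ∞) {q : ℝ} (hq : 1 < q) (a : ι → ℝ≥0∞) :
    ∫⁻ x, potential s a x ^ q ∂μ
      ≤ wolffConst q * ∑' Q, a Q * μ (s Q) * avgSum s μ a Q ^ (q - 1) := by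
  have hq0 : 0 < q := by linarith
  have htrunc : ∀ z : ℝ≥0∞, ⨆ N : ℕ, min z N = z := fun z => by
    rw [← inf_iSup_eq, ENNReal.iSup_natCast, inf_top_eq]
  have hmono : ∀ Q x, Monotone fun N : ℕ => (s Q).indicator (fun _ => min (a Q) N) x :=
    fun Q x M N hMN => by
      refine Set.indicator_le_indicator ?_
      gcongr
  have hpt : ∀ x, potential s a x ^ q = ⨆ F : Finset ι, ⨆ N : ℕ,
      (∑ Q ∈ F, (s Q).indicator (fun _ => min (a Q) N) x) ^ q := by
    intro x
    simp_rw [← iSup_rpow' _ hq0]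
    congr 1
    rw [potential, ENNReal.tsum_eq_iSup_sum]
    refine iSup_congr fun F => ?_
    rw [← ENNReal.finsetSum_iSup_of_monotone fun Q => hmono Q x]
    refine Finset.sum_congr rfl fun Q _ => ?_
    by_cases hx : x ∈ s Q
    · simp only [Set.indicator_of_mem hx, htrunc]
    · simp [hx]
  simp_rw [hpt]
  have hmeas : ∀ (F : Finset ι) (N : ℕ), Measurable fun x =>
      (∑ Q ∈ F, (s Q).indicator (fun _ => min (a Q) N) x) ^ q := fun F N =>
    (Finset.measurable_sum _ fun Q _ => measurable_const.indicator (hs.measurable Q)).pow_const q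
  rw [lintegral_iSup_directed fun F => (Measurable.iSup fun N => hmeas F N).aemeasurable]
  · refine iSup_le fun F => ?_
    rw [lintegral_iSup (hmeas F)]
    · refine iSup_le fun N => ?_
      refine (lintegral_sum_indicator_rpow_le hs hfin hq _ (fun Q =>
        ne_top_of_le_ne_top (ENNReal.natCast_ne_top N) (min_le_right _ _)) F).trans ?_
      gcongr with Q
      · exact min_le_left _ _
      · exact avgSum_mono (fun Q => min_le_left _ _) Q
    · intro M N hMN x
      refine ENNReal.rpow_le_rpow (Finset.sum_le_sum fun Q _ => hmono Q x hMN) hq0.le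
  · refine Monotone.directed_le fun F G hFG x => ?_
    exact iSup_mono fun N => ENNReal.rpow_le_rpow (Finset.sum_le_sum_of_subset hFG) hq0.le

/-- The discrete Wolff sum of a potential is controlled by its norm, because the averages are
dominated by the maximal function of the potential. -/
theorem tsum_mul_avgSum_rpow_le [Countable ι] (hs : NestedFamily s)
    (hfin : ∀ Q, μ (s Q) ≠ ∞) {q : ℝ} (hq : 1 < q) (a : ι → ℝ≥0∞) :
    ∑' Q, a Q * μ (s Q) * avgSum s μ a Q ^ (q - 1)
      ≤ maxConst q ^ (1 - 1 / q) * ∫⁻ x, potential s a x ^ q ∂μ := by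
  have hpq := Real.HolderConjugate.conjExponent hq
  have hm := measurable_potential hs a
  calc ∑' Q, a Q * μ (s Q) * avgSum s μ a Q ^ (q - 1)
      = ∫⁻ x, ∑' Q, (s Q).indicator (fun _ => a Q * avgSum s μ a Q ^ (q - 1)) x ∂μ := by
        rw [lintegral_tsum fun Q => (measurable_const.indicator (hs.measurable Q)).aemeasurable]
        refine tsum_congr fun Q => ?_
        rw [lintegral_indicator_const (hs.measurable Q)]
        ring
    _ ≤ ∫⁻ x, potential s a x * maxFn s μ (potential s a) x ^ (q - 1) ∂μ := by
        refine lintegral_mono fun x => ?_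
        rw [potential, ← ENNReal.tsum_mul_right]
        refine ENNReal.tsum_le_tsum fun Q => ?_
        by_cases hx : x ∈ s Q
        · rw [Set.indicator_of_mem hx, Set.indicator_of_mem hx]
          gcongr
          exact (avgSum_le_average_potential hs a Q).trans (average_le_maxFn hx)
        · simp [hx]
    _ ≤ _ := by
        have hH := ENNReal.lintegral_mul_le_Lp_mul_Lq μ hpq hm.aemeasurable
          ((measurable_maxFn (μ := μ) (f := potential s a) hs).pow_const (q - 1)).aemeasurable
        simp only [Pi.mul_apply, ← ENNReal.rpow_mul, hpq.sub_one_mul_conj] at hH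
        have hexp : 1 / q.conjExponent = 1 - 1 / q := by
          have := hpq.inv_add_inv_eq_one
          rw [one_div, one_div]
          linarith
        have hnn : 0 ≤ 1 - 1 / q := by rw [← hexp]; have := hpq.symm.pos; positivity
        rw [hexp] at hH
        refine hH.trans ?_
        calc _ ≤ (∫⁻ x, potential s a x ^ q ∂μ) ^ (1 / q) *
              (maxConst q * ∫⁻ x, potential s a x ^ q ∂μ) ^ (1 - 1 / q) := by
              gcongr
              exact lintegral_maxFn_rpow_le hs hfin hq hm
          _ = maxConst q ^ (1 - 1 / q) * ((∫⁻ x, potential s a x ^ q ∂μ) ^ (1 / q) *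
              (∫⁻ x, potential s a x ^ q ∂μ) ^ (1 - 1 / q)) := by
              rw [ENNReal.mul_rpow_of_nonneg _ _ hnn]
              ring
          _ = _ := by
              rw [← ENNReal.rpow_add_of_nonneg _ _ (by positivity) hnn]
              simp

end Potential

/-- Duality: a bound on the pairing with every function of finite `L ^ p` norm bounds the `L ^ q`
norm, `q` being the conjugate exponent. -/
theorem lintegral_rpow_le_of_forall_pairing {X : Type*} [MeasurableSpace X] {μ : Measure X}
    [SigmaFinite μ] {p q : ℝ} (hpq : p.HolderConjugate q) {S : X → ℝ≥0∞} (hS : Measurable S)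
    {c : ℝ≥0∞} (h : ∀ f : X → ℝ≥0∞, Measurable f → ∫⁻ x, f x ^ p ∂μ ≠ ∞ →
      ∫⁻ x, S x * f x ∂μ ≤ c * (∫⁻ x, f x ^ p ∂μ) ^ (1 / p)) :
    ∫⁻ x, S x ^ q ∂μ ≤ c ^ q := by
  have hq0 := hpq.symm.pos
  set g : ℕ → X → ℝ≥0∞ := fun N => (spanningSets μ N).indicator fun x => min (S x) N with hg
  have hgm : ∀ N, Measurable (g N) := fun N =>
    (hS.min measurable_const).indicator (measurableSet_spanningSets μ N)
  have hgS : ∀ N x, g N x ≤ S x := fun N x =>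
    (Set.indicator_le_self' (fun _ _ => zero_le) x).trans (min_le_left _ _)
  have hgmono : Monotone g := by
    intro M N hMN x
    refine (Set.indicator_le_indicator_of_subset (monotone_spanningSets μ hMN)
      (fun _ => zero_le) x).trans (Set.indicator_le_indicator ?_)
    gcongr
  have hsup : ∀ x, ⨆ N, g N x = S x := by
    intro x
    refine le_antisymm (iSup_le fun N => hgS N x) ?_
    have htrunc : S x = ⨆ N : ℕ, min (S x) N := by
      rw [← inf_iSup_eq, ENNReal.iSup_natCast, inf_top_eq]
    rw [htrunc]
    refine iSup_le fun N => ?_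
    obtain ⟨M, hM⟩ := Set.mem_iUnion.1 ((iUnion_spanningSets μ).symm ▸ Set.mem_univ x)
    refine le_trans ?_ (le_iSup _ (max M N))
    rw [hg]
    simp only
    rw [Set.indicator_of_mem (monotone_spanningSets μ (le_max_left M N) hM)]
    gcongr
    exact le_max_right _ _
  have hbound : ∀ N, ∫⁻ x, g N x ^ q ∂μ ≤ c ^ q := by
    intro N
    have hfinite : ∫⁻ x, g N x ^ q ∂μ ≠ ∞ := by
      have : ∀ x, g N x ^ q ≤ (spanningSets μ N).indicator (fun _ => (N : ℝ≥0∞) ^ q) x := by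
        intro x
        by_cases hx : x ∈ spanningSets μ N
        · simp only [hg, Set.indicator_of_mem hx]
          gcongr
          exact min_le_right _ _
        · simp [hg, hx, hq0]
      refine ne_top_of_le_ne_top ?_ (lintegral_mono this)
      rw [lintegral_indicator_const (measurableSet_spanningSets μ N)]
      exact ENNReal.mul_ne_top (ENNReal.rpow_ne_top_of_nonneg hq0.le (ENNReal.natCast_ne_top N))
        (measure_spanningSets_lt_top μ N).ne
    have hpow : ∀ x, (g N x ^ (q - 1)) ^ p = g N x ^ q := fun x => by
      rw [← ENNReal.rpow_mul, hpq.symm.sub_one_mul_conj]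
    have h' := h (fun x => g N x ^ (q - 1)) ((hgm N).pow_const _)
    simp only [hpow] at h'
    refine rpow_conj_le hpq.symm hfinite (le_trans ?_ (h' hfinite))
    refine lintegral_mono fun x => ?_
    have : q = 1 + (q - 1) := by ring
    nth_rewrite 1 [this]
    rw [ENNReal.rpow_add_of_nonneg _ _ zero_le_one hpq.symm.sub_one_pos.le, ENNReal.rpow_one]
    gcongr
    exact hgS N x
  have : ∀ x, S x ^ q = ⨆ N, g N x ^ q := fun x => by rw [← hsup, iSup_rpow' _ hq0]
  simp_rw [this]
  rw [lintegral_iSup fun N => (hgm N).pow_const q]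
  · exact iSup_le hbound
  · exact fun M N hMN x => ENNReal.rpow_le_rpow (hgmono hMN x) hq0.le

/-! ### Positive embeddings and the transformed kernel -/

section Embedding

variable {X ι κ : Type*} [MeasurableSpace X]

/-- The multilinear embedding with constant `c`, kernel `K` and exponents `P`, for the measures
`σ i`, `i ∈ t`, and tested on nonnegative functions of finite norm. For `t = ∅` it says that the sum
of the kernel is at most `c`. -/
def PosEmbedding (s : ι → Set X) (σ : κ → Measure X) (P : κ → ℝ) (t : Finset κ) (K : ι → ℝ≥0∞)
    (c : ℝ≥0∞) : Prop :=
  ∀ f : κ → X → ℝ≥0∞, (∀ i, Measurable (f i)) → (∀ i ∈ t, ∫⁻ x, f i x ^ P i ∂σ i ≠ ∞) →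
    ∑' Q, K Q * ∏ i ∈ t, ∫⁻ x in s Q, f i x ∂σ i
      ≤ c * ∏ i ∈ t, (∫⁻ x, f i x ^ P i ∂σ i) ^ (1 / P i)

/-- The passage from the kernel `K^φ_{j-1}` to `K^φ_j`: the measure `μ` is eliminated, `τ` is the
product of the measures not eliminated before, and `q` is the ratio of the exponents. -/
noncomputable def stepKernel (s : ι → Set X) (μ : Measure X) (q : ℝ) (τ K : ι → ℝ≥0∞) (Q : ι) :
    ℝ≥0∞ :=
  K Q * μ (s Q) * ((μ (s Q))⁻¹ * ∑' Q' : {Q' // s Q' ⊆ s Q}, K Q' * τ Q') ^ (q - 1)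

variable {s : ι → Set X} {μ : Measure X}

theorem stepKernel_eq [DecidableEq κ] (σ : κ → Measure X) (q : ℝ) {t : Finset κ} {i : κ}
    (hi : i ∈ t) (K : ι → ℝ≥0∞) (Q : ι) :
    stepKernel s (σ i) q (fun Q => ∏ j ∈ t, σ j (s Q)) K Q
      = K Q * σ i (s Q) *
        avgSum s (σ i) (fun Q => K Q * ∏ j ∈ t.erase i, σ j (s Q)) Q ^ (q - 1) := by
  unfold stepKernel avgSum
  have hR : ∀ R, K R * ∏ j ∈ t, σ j (s R) = K R * (∏ j ∈ t.erase i, σ j (s R)) * σ i (s R) :=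
    fun R => by
      rw [← Finset.mul_prod_erase t _ hi]
      ring
  simp only [hR]

theorem measure_mul_average (hfin : ∀ Q, μ (s Q) ≠ ∞) (f : X → ℝ≥0∞) (Q : ι) :
    μ (s Q) * ((μ (s Q))⁻¹ * ∫⁻ x in s Q, f x ∂μ) = ∫⁻ x in s Q, f x ∂μ := by
  by_cases h0 : μ (s Q) = 0
  · simp [Measure.restrict_eq_zero.2 h0, h0]
  · rw [← mul_assoc, ENNReal.mul_inv_cancel h0 (hfin Q), one_mul]

theorem mul_measure_le_setLIntegral (hs : NestedFamily s) {f : X → ℝ≥0∞} {Q : ι} {m : ℝ≥0∞}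
    (h : ∀ x ∈ s Q, m ≤ f x) : m * μ (s Q) ≤ ∫⁻ x in s Q, f x ∂μ := by
  rw [← setLIntegral_const]
  exact setLIntegral_mono' (hs.measurable Q) h

theorem prod_rpow_mul_self [DecidableEq κ] (T : Finset κ) (m : κ → ℝ≥0∞) {q : ℝ} (hq : 1 < q) :
    (∏ j ∈ T, m j ^ (1 / q)) * (∏ j ∈ T, m j ^ (1 / q)) ^ (q - 1) = ∏ j ∈ T, m j := by
  have hq0 : 0 < q := by linarith
  set D := ∏ j ∈ T, m j ^ (1 / q) with hD
  have : D * D ^ (q - 1) = D ^ q := by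
    have h : q = 1 + (q - 1) := by ring
    conv_rhs => rw [h]
    rw [ENNReal.rpow_add_of_nonneg _ _ zero_le_one (by linarith), ENNReal.rpow_one]
  rw [this, hD, ← ENNReal.prod_rpow_of_nonneg hq0.le]
  refine Finset.prod_congr rfl fun j _ => ?_
  rw [← ENNReal.rpow_mul, one_div_mul_cancel hq0.ne', ENNReal.rpow_one]

/-- The constant in the passage from an embedding to the embedding with one measure eliminated. -/
noncomputable def eliminateConst [DecidableEq κ] (P : κ → ℝ) (t : Finset κ) (i : κ) (q : ℝ) :
    ℝ≥0∞ :=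
  maxConst q ^ (1 - 1 / q) * ∏ j ∈ t.erase i, maxConst (P j / q) ^ (1 / (P j / q))

/-- An embedding implies the embedding in which the measure `σ i` is eliminated. It is tested on
`(M g_j) ^ (1 / q)`: on a set `Q` these functions are bounded below by a power of the average of
`g_j` over `Q`, which can be taken out of the sums over the subsets of `Q`. -/
theorem PosEmbedding.eliminate [Countable ι] [DecidableEq κ] (hs : NestedFamily s)
    {σ : κ → Measure X} [∀ i, SigmaFinite (σ i)] (hfin : ∀ i Q, σ i (s Q) ≠ ∞)
    {P : κ → ℝ} {t : Finset κ} {i : κ} (hi : i ∈ t) {q : ℝ} (hpq : (P i).HolderConjugate q)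
    (hP : ∀ j ∈ t.erase i, q < P j) {K : ι → ℝ≥0∞} {c : ℝ≥0∞} (h : PosEmbedding s σ P t K c) :
    PosEmbedding s σ (fun j => P j / q) (t.erase i)
      (stepKernel s (σ i) q (fun Q => ∏ j ∈ t, σ j (s Q)) K) (eliminateConst P t i q * c ^ q) := by
  intro g hg hgfin
  have hq1 : 1 < q := hpq.symm.lt
  have hq0 : 0 < q := hpq.symm.pos
  set f : κ → X → ℝ≥0∞ := fun j x => maxFn s (σ j) (g j) x ^ (1 / q) with hf
  have hMm : ∀ j, Measurable (maxFn s (σ j) (g j)) := fun j => measurable_maxFn hs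
  have hfm : ∀ j, Measurable (f j) := fun j => (hMm j).pow_const _
  have hPq : ∀ j ∈ t.erase i, 1 < P j / q := fun j hj => by
    rw [lt_div_iff₀ hq0]; simpa using hP j hj
  have hMax : ∀ j ∈ t.erase i, ∫⁻ x, maxFn s (σ j) (g j) x ^ (P j / q) ∂σ j
      ≤ maxConst (P j / q) * ∫⁻ x, g j x ^ (P j / q) ∂σ j := fun j hj =>
    lintegral_maxFn_rpow_le hs (hfin j) (hPq j hj) (hg j)
  have hfpow : ∀ j, ∫⁻ x, f j x ^ P j ∂σ j = ∫⁻ x, maxFn s (σ j) (g j) x ^ (P j / q) ∂σ j :=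
    fun j => by
      refine lintegral_congr fun x => ?_
      simp only [hf, ← ENNReal.rpow_mul]
      congr 1
      ring
  set a : ι → ℝ≥0∞ := fun Q => K Q * ∏ j ∈ t.erase i, ∫⁻ x in s Q, f j x ∂σ j with ha
  set a₀ : ι → ℝ≥0∞ := fun Q => K Q * ∏ j ∈ t.erase i, σ j (s Q) with ha₀
  set N := ∏ j ∈ t.erase i, (∫⁻ x, f j x ^ P j ∂σ j) ^ (1 / P j) with hN
  have hdual : ∫⁻ x, potential s a x ^ q ∂σ i ≤ (c * N) ^ q := by
    refine lintegral_rpow_le_of_forall_pairing hpq (measurable_potential hs a) fun f₀ hf₀ hf₀p => ?_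
    have h' := h (Function.update f i f₀)
      (fun j => by
        by_cases hj : j = i
        · subst hj; simpa using hf₀
        · simpa [hj] using hfm j)
      (fun j hj => by
        by_cases hji : j = i
        · subst hji; simpa using hf₀p
        · rw [Function.update_of_ne hji, hfpow]
          have hj' := Finset.mem_erase.2 ⟨hji, hj⟩
          exact ne_top_of_le_ne_top (ENNReal.mul_ne_top (maxConst_ne_top (hPq j hj'))
            (hgfin j hj')) (hMax j hj'))
    simp_rw [← Finset.mul_prod_erase t _ hi, Function.update_self] at h'
    have hcongr : ∀ Q, ∏ j ∈ t.erase i, ∫⁻ x in s Q, Function.update f i f₀ j x ∂σ j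
        = ∏ j ∈ t.erase i, ∫⁻ x in s Q, f j x ∂σ j := fun Q =>
      Finset.prod_congr rfl fun j hj => by rw [Function.update_of_ne (Finset.ne_of_mem_erase hj)]
    have hcongr' : ∏ j ∈ t.erase i, (∫⁻ x, Function.update f i f₀ j x ^ P j ∂σ j) ^ (1 / P j)
        = N :=
      Finset.prod_congr rfl fun j hj => by rw [Function.update_of_ne (Finset.ne_of_mem_erase hj)]
    simp_rw [hcongr, hcongr'] at h'
    calc ∫⁻ x, potential s a x * f₀ x ∂σ i
        = ∑' Q, K Q * ((∫⁻ x in s Q, f₀ x ∂σ i) *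
            ∏ j ∈ t.erase i, ∫⁻ x in s Q, f j x ∂σ j) := by
          simp_rw [potential, ← ENNReal.tsum_mul_right]
          rw [lintegral_tsum (f := fun Q x => (s Q).indicator (fun _ => a Q) x * f₀ x) fun Q =>
            ((measurable_const.indicator (hs.measurable Q)).mul hf₀).aemeasurable]
          refine tsum_congr fun Q => ?_
          have : ∀ x, (s Q).indicator (fun _ => a Q) x * f₀ x
              = (s Q).indicator (fun x => a Q * f₀ x) x := fun x => by
            by_cases hx : x ∈ s Q <;> simp [hx]
          simp_rw [this]
          rw [lintegral_indicator (hs.measurable Q), lintegral_const_mul _ hf₀, ha]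
          ring
      _ ≤ c * ((∫⁻ x, f₀ x ^ P i ∂σ i) ^ (1 / P i) * N) := h'
      _ = c * N * (∫⁻ x, f₀ x ^ P i ∂σ i) ^ (1 / P i) := by ring
  have hpt : ∀ Q, stepKernel s (σ i) q (fun Q => ∏ j ∈ t, σ j (s Q)) K Q *
      ∏ j ∈ t.erase i, ∫⁻ x in s Q, g j x ∂σ j
        ≤ a Q * σ i (s Q) * avgSum s (σ i) a Q ^ (q - 1) := by
    intro Q
    set m : κ → ℝ≥0∞ := fun j => (σ j (s Q))⁻¹ * ∫⁻ x in s Q, g j x ∂σ j with hm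
    set D := ∏ j ∈ t.erase i, m j ^ (1 / q) with hD
    have hlow : ∀ R, s R ⊆ s Q → D * a₀ R ≤ a R := by
      intro R hR
      calc D * a₀ R = K R * ∏ j ∈ t.erase i, m j ^ (1 / q) * σ j (s R) := by
            rw [ha₀, Finset.prod_mul_distrib]; ring
        _ ≤ a R := by
            simp only [ha]
            gcongr with j hj
            refine mul_measure_le_setLIntegral hs fun x hx => ?_
            exact ENNReal.rpow_le_rpow (average_le_maxFn (hR hx)) (by positivity)
    have havg : D * avgSum s (σ i) a₀ Q ≤ avgSum s (σ i) a Q := by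
      unfold avgSum
      rw [mul_left_comm, ← ENNReal.tsum_mul_left]
      simp_rw [← mul_assoc D]
      gcongr with R
      exact hlow R R.2
    calc _ = K Q * σ i (s Q) * avgSum s (σ i) a₀ Q ^ (q - 1) *
          ∏ j ∈ t.erase i, σ j (s Q) * m j := by
          rw [stepKernel_eq σ q hi]
          congr 1
          exact Finset.prod_congr rfl fun j _ => (measure_mul_average (hfin j) _ _).symm
      _ = a₀ Q * σ i (s Q) * avgSum s (σ i) a₀ Q ^ (q - 1) * (D * D ^ (q - 1)) := by
          rw [Finset.prod_mul_distrib, hD, prod_rpow_mul_self _ _ hq1, ha₀]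
          ring
      _ = (D * a₀ Q) * σ i (s Q) * (D * avgSum s (σ i) a₀ Q) ^ (q - 1) := by
          rw [ENNReal.mul_rpow_of_nonneg _ _ hpq.symm.sub_one_pos.le]
          ring
      _ ≤ _ := by
          have := hpq.symm.sub_one_pos.le
          gcongr
          exact hlow Q subset_rfl
  refine (ENNReal.tsum_le_tsum hpt).trans
    ((tsum_mul_avgSum_rpow_le hs (hfin i) hq1 a).trans ?_)
  have hNq : N ^ q ≤ (∏ j ∈ t.erase i, maxConst (P j / q) ^ (1 / (P j / q))) *
      ∏ j ∈ t.erase i, (∫⁻ x, g j x ^ (P j / q) ∂σ j) ^ (1 / (P j / q)) := by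
    rw [hN, ← ENNReal.prod_rpow_of_nonneg hq0.le, ← Finset.prod_mul_distrib]
    refine Finset.prod_le_prod' fun j hj => ?_
    have hPj : 0 < P j := hq0.trans (hP j hj)
    have hexp : 1 / P j * q = 1 / (P j / q) := by field_simp
    rw [← ENNReal.rpow_mul, hexp, hfpow, ← ENNReal.mul_rpow_of_nonneg _ _ (by positivity)]
    exact ENNReal.rpow_le_rpow (hMax j hj) (by positivity)
  calc maxConst q ^ (1 - 1 / q) * ∫⁻ x, potential s a x ^ q ∂σ i
      ≤ maxConst q ^ (1 - 1 / q) * (c ^ q * N ^ q) := by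
        rw [← ENNReal.mul_rpow_of_nonneg _ _ hq0.le]
        gcongr
    _ ≤ maxConst q ^ (1 - 1 / q) * (c ^ q *
        ((∏ j ∈ t.erase i, maxConst (P j / q) ^ (1 / (P j / q))) *
          ∏ j ∈ t.erase i, (∫⁻ x, g j x ^ (P j / q) ∂σ j) ^ (1 / (P j / q)))) := by gcongr
    _ = _ := by
        unfold eliminateConst
        ring

/-- The part of a potential inside `R`, with the averages of the whole potential. -/
theorem lintegral_potential_inside_rpow_le [Countable ι] (hs : NestedFamily s)
    (hfin : ∀ Q, μ (s Q) ≠ ∞) {q : ℝ} (hq : 1 < q) (a : ι → ℝ≥0∞) (R : ι) :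
    ∫⁻ x, potential s ({Q | s Q ⊆ s R}.indicator a) x ^ q ∂μ
      ≤ wolffConst q *
        ∑' Q, {Q | s Q ⊆ s R}.indicator (fun Q => a Q * μ (s Q) * avgSum s μ a Q ^ (q - 1)) Q := by
  refine (lintegral_potential_rpow_le hs hfin hq _).trans ?_
  gcongr with Q
  by_cases hQ : s Q ⊆ s R
  · rw [Set.indicator_of_mem (by exact hQ), Set.indicator_of_mem (by exact hQ)]
    gcongr
    exact avgSum_mono (fun Q => Set.indicator_le_self' (fun _ _ => zero_le) Q) Q
  · rw [Set.indicator_of_notMem (by exact hQ)]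
    simp

theorem avgSum_indicator (a : ι → ℝ≥0∞) (R : ι) :
    avgSum s μ ({Q | s Q ⊆ s R}.indicator a) R = avgSum s μ a R := by
  unfold avgSum
  congr 1
  refine tsum_congr fun Q => ?_
  rw [Set.indicator_of_mem (by exact Q.2)]

open Classical in
/-- The estimate of the part of the sum in which the function paired with `μ` has the smallest
stopping set. Here `d` stands for the increments of its maximal averages, `w` for the product of the
maximal averages of the other functions. The weight `w` is itself resolved into increments, so that
the unweighted bound of the norm of a potential suffices. -/
theorem sum_increments_mul_le [Countable ι] (hs : NestedFamily s) (hfin : ∀ Q, μ (s Q) ≠ ∞)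
    {p q : ℝ} (hpq : p.HolderConjugate q) (a : ι → ℝ≥0∞) (F : Finset ι) (d w : ι → ℝ≥0∞)
    {g : X → ℝ≥0∞} (hg : Measurable g) (hd : ∀ x, ∑ R ∈ F.filter (fun R => x ∈ s R), d R ≤ g x)
    (hw : ∀ Q R, s Q ⊆ s R → w R ≤ w Q) :
    ∑ R ∈ F, d R * w R * ∑' Q : {Q // s Q ⊆ s R}, a Q * μ (s Q)
      ≤ (∫⁻ x, g x ^ p ∂μ) ^ (1 / p) * (maxConst q * (wolffConst q *
        ∑' Q, a Q * μ (s Q) * avgSum s μ a Q ^ (q - 1) * w Q ^ q)) ^ (1 / q) := by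
  have hq1 : 1 < q := hpq.symm.lt
  have hq0 : 0 < q := hpq.symm.pos
  obtain ⟨v, hv, hv'⟩ := hs.exists_increments (fun Q => w Q ^ q)
    (fun Q R h => ENNReal.rpow_le_rpow (hw Q R h) hq0.le) F
  set S : ι → X → ℝ≥0∞ := fun R => potential s ({Q | s Q ⊆ s R}.indicator a) with hS
  have hSm : ∀ R, Measurable (S R) := fun R => measurable_potential hs _
  have hSmono : ∀ R R', s R ⊆ s R' → ∀ x, S R x ≤ S R' x := fun R R' hR x => by
    refine ENNReal.tsum_le_tsum fun Q => Set.indicator_le_indicator ?_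
    exact Set.indicator_le_indicator_of_subset (fun Q hQ => Set.Subset.trans hQ hR)
      (fun _ => zero_le) Q
  set G : X → ℝ≥0∞ := fun x => (∑ R ∈ F, v R * S R x ^ q) ^ (1 / q) with hG
  have hGm : Measurable G :=
    (Finset.measurable_sum _ fun R _ => ((hSm R).pow_const q).const_mul _).pow_const _
  have hGlow : ∀ R ∈ F, ∀ x, w R * S R x ≤ G x := by
    intro R hR x
    have h1 : (w R * S R x) ^ q ≤ ∑ R ∈ F, v R * S R x ^ q := by
      rw [ENNReal.mul_rpow_of_nonneg _ _ hq0.le, ← hv R hR, Finset.sum_mul]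
      refine (Finset.sum_le_sum fun R' hR' => ?_).trans
        (Finset.sum_le_sum_of_subset (Finset.filter_subset _ _))
      gcongr
      exact hSmono R R' (Finset.mem_filter.1 hR').2 x
    calc w R * S R x = ((w R * S R x) ^ q) ^ (1 / q) := by
          rw [← ENNReal.rpow_mul, mul_one_div_cancel hq0.ne', ENNReal.rpow_one]
      _ ≤ G x := ENNReal.rpow_le_rpow h1 (by positivity)
  have hGq : ∫⁻ x, G x ^ q ∂μ ≤ wolffConst q *
      ∑' Q, a Q * μ (s Q) * avgSum s μ a Q ^ (q - 1) * w Q ^ q := by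
    have : ∀ x, G x ^ q = ∑ R ∈ F, v R * S R x ^ q := fun x => by
      rw [hG, ← ENNReal.rpow_mul, one_div_mul_cancel hq0.ne', ENNReal.rpow_one]
    simp_rw [this]
    rw [lintegral_finsetSum _ fun R _ => ((hSm R).pow_const q).const_mul _]
    simp_rw [lintegral_const_mul _ ((hSm _).pow_const q)]
    calc ∑ R ∈ F, v R * ∫⁻ x, S R x ^ q ∂μ
        ≤ ∑ R ∈ F, v R * (wolffConst q * ∑' Q, {Q | s Q ⊆ s R}.indicator
            (fun Q => a Q * μ (s Q) * avgSum s μ a Q ^ (q - 1)) Q) := by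
          gcongr with R hR
          exact lintegral_potential_inside_rpow_le hs hfin hq1 a R
      _ = wolffConst q * ∑' Q, a Q * μ (s Q) * avgSum s μ a Q ^ (q - 1) *
            ∑ R ∈ F.filter (fun R => s Q ⊆ s R), v R := by
          simp_rw [← ENNReal.tsum_mul_left]
          rw [← Summable.tsum_finsetSum fun _ _ => ENNReal.summable]
          refine tsum_congr fun Q => ?_
          rw [Finset.sum_filter, Finset.mul_sum, Finset.mul_sum]
          refine Finset.sum_congr rfl fun R _ => ?_
          by_cases h : s Q ⊆ s R
          · simp [h]; ring
          · simp [h]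
      _ ≤ _ := by
          gcongr with Q
          exact hv' Q
  have hpt : ∀ R ∈ F, ∀ x ∈ s R, w R * avgSum s μ a R ≤ maxFn s μ G x := by
    intro R hR x hx
    refine le_trans ?_ (average_le_maxFn hx)
    calc w R * avgSum s μ a R
        ≤ w R * ((μ (s R))⁻¹ * ∫⁻ x in s R, S R x ∂μ) := by
          gcongr
          rw [← avgSum_indicator]
          exact avgSum_le_average_potential hs _ R
      _ = (μ (s R))⁻¹ * ∫⁻ x in s R, w R * S R x ∂μ := by
          rw [lintegral_const_mul _ (hSm R)]
          ring
      _ ≤ _ := by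
          gcongr with x
          exact hGlow R hR x
  calc ∑ R ∈ F, d R * w R * ∑' Q : {Q // s Q ⊆ s R}, a Q * μ (s Q)
      = ∫⁻ x, ∑ R ∈ F, (s R).indicator (fun _ => d R * (w R * avgSum s μ a R)) x ∂μ := by
        rw [lintegral_finsetSum _ fun R _ => measurable_const.indicator (hs.measurable R)]
        refine Finset.sum_congr rfl fun R _ => ?_
        rw [lintegral_indicator_const (hs.measurable R), ← mul_avgSum hfin]
        ring
    _ ≤ ∫⁻ x, g x * maxFn s μ G x ∂μ := by
        refine lintegral_mono fun x => ?_
        calc ∑ R ∈ F, (s R).indicator (fun _ => d R * (w R * avgSum s μ a R)) x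
            = ∑ R ∈ F.filter (fun R => x ∈ s R), d R * (w R * avgSum s μ a R) :=
              sum_indicator_eq _ _ _
          _ ≤ ∑ R ∈ F.filter (fun R => x ∈ s R), d R * maxFn s μ G x := by
              refine Finset.sum_le_sum fun R hR => ?_
              gcongr
              exact hpt R (Finset.mem_filter.1 hR).1 x (Finset.mem_filter.1 hR).2
          _ ≤ _ := by
              rw [← Finset.sum_mul]
              gcongr
              exact hd x
    _ ≤ (∫⁻ x, g x ^ p ∂μ) ^ (1 / p) * (∫⁻ x, maxFn s μ G x ^ q ∂μ) ^ (1 / q) :=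
        ENNReal.lintegral_mul_le_Lp_mul_Lq μ hpq hg.aemeasurable (measurable_maxFn hs).aemeasurable
    _ ≤ _ := by
        gcongr
        refine (lintegral_maxFn_rpow_le hs hfin hq1 hGm).trans ?_
        gcongr

/-- The constant in the passage to an embedding from all embeddings with one measure eliminated. -/
noncomputable def combineConst (P : κ → ℝ) (t : Finset κ) (q : κ → ℝ) : ℝ≥0∞ :=
  ∑ i ∈ t, (maxConst (q i) * wolffConst (q i)) ^ (1 / q i) *
    ∏ j ∈ t, maxConst (P j) ^ (1 / P j)

open Classical in
theorem sum_increments_le_of_mem (hs : NestedFamily s) {u d : ι → ℝ≥0∞} {F : Finset ι}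
    {g : X → ℝ≥0∞} (hd : ∀ Q ∈ F, ∑ R ∈ F.filter (fun R => s Q ⊆ s R), d R = u Q)
    (hu : ∀ Q, ∀ x ∈ s Q, u Q ≤ g x) (x : X) :
    ∑ R ∈ F.filter (fun R => x ∈ s R), d R ≤ g x := by
  rcases (F.filter fun R => x ∈ s R).eq_empty_or_nonempty with h | h
  · simp [h]
  obtain ⟨Q, hQ, hmin⟩ := exists_top_of_total (r := fun R Q => s Q ⊆ s R)
    (fun _ _ _ h h' => h'.trans h) _ h fun Q hQ R hR => (hs.nested Q R
      ⟨x, (Finset.mem_filter.1 hQ).2, (Finset.mem_filter.1 hR).2⟩).symm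
  have hQ' := Finset.mem_filter.1 hQ
  refine le_trans (Finset.sum_le_sum_of_subset fun R hR => ?_)
    ((hd Q hQ'.1).le.trans (hu Q x hQ'.2))
  exact Finset.mem_filter.2 ⟨(Finset.mem_filter.1 hR).1, hmin R hR⟩

/-- If, for every `i ∈ t`, the embedding with the measure `σ i` eliminated holds, then so does the
embedding itself. The product of the maximal averages is expanded into increments; among the sets
carrying the increments the smallest belongs to some `i ∈ t`, and for that part of the sum the
hypothesis for this `i` is used. -/
theorem PosEmbedding.of_eliminate [Countable ι] [DecidableEq κ] (hs : NestedFamily s)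
    {σ : κ → Measure X} (hfin : ∀ i Q, σ i (s Q) ≠ ∞)
    {P : κ → ℝ} {t : Finset κ} (ht : t.Nonempty) {q : κ → ℝ}
    (hpq : ∀ i ∈ t, (P i).HolderConjugate (q i))
    {K : ι → ℝ≥0∞} {c : ℝ≥0∞}
    (h : ∀ i ∈ t, PosEmbedding s σ (fun j => P j / q i) (t.erase i)
      (stepKernel s (σ i) (q i) (fun Q => ∏ j ∈ t, σ j (s Q)) K) (c ^ q i)) :
    PosEmbedding s σ P t K (combineConst P t q * c) := by
  classical
  intro f hf hffin
  rw [ENNReal.tsum_eq_iSup_sum]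
  refine iSup_le fun F => ?_
  have hMm : ∀ j, Measurable (maxFn s (σ j) (f j)) := fun j => measurable_maxFn hs
  have hMax : ∀ j ∈ t, ∫⁻ x, maxFn s (σ j) (f j) x ^ P j ∂σ j
      ≤ maxConst (P j) * ∫⁻ x, f j x ^ P j ∂σ j := fun j hj =>
    lintegral_maxFn_rpow_le hs (hfin j) (hpq j hj).lt (hf j)
  -- A monotone substitute for the average over `Q`: the infimum over `Q` of the maximal function.
  set u : κ → ι → ℝ≥0∞ := fun j Q => ⨅ x ∈ s Q, maxFn s (σ j) (f j) x with hu
  have hu_le : ∀ j Q, ∀ x ∈ s Q, u j Q ≤ maxFn s (σ j) (f j) x := fun j Q x hx =>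
    iInf₂_le x hx
  have hu_mono : ∀ j Q R, s Q ⊆ s R → u j R ≤ u j Q := fun j Q R hQR =>
    le_iInf₂ fun x hx => iInf₂_le x (hQR hx)
  have havg : ∀ j Q, ∫⁻ x in s Q, f j x ∂σ j ≤ σ j (s Q) * u j Q := fun j Q => by
    rw [← measure_mul_average (hfin j)]
    gcongr
    exact le_iInf₂ fun x hx => average_le_maxFn hx
  choose d hd hd' using fun j => hs.exists_increments (u j) (hu_mono j) F
  set w : κ → ι → ℝ≥0∞ := fun i Q => ∏ l ∈ t.erase i, u l Q with hw
  set a : κ → ι → ℝ≥0∞ := fun i Q => K Q * ∏ l ∈ t.erase i, σ l (s Q) with ha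
  have hprod : ∀ Q ∈ F, ∏ i ∈ t, u i Q ≤
      ∑ R ∈ F.filter (fun R => s Q ⊆ s R), ∑ i ∈ t, d i R * w i R := by
    intro Q hQ
    obtain ⟨x, hx⟩ := hs.nonempty Q
    have h1 := prod_sum_le_of_chain (r := fun R Q => s Q ⊆ s R) (fun _ _ _ h h' => h'.trans h)
      t ht d (F.filter fun R => s Q ⊆ s R) fun R hR R' hR' =>
        (hs.nested R R' ⟨x, (Finset.mem_filter.1 hR).2 hx, (Finset.mem_filter.1 hR').2 hx⟩).symm
    simp_rw [hd _ Q hQ] at h1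
    refine h1.trans ?_
    refine Finset.sum_le_sum fun R _ => Finset.sum_le_sum fun i _ => ?_
    gcongr
    refine Finset.prod_le_prod' fun l _ => ?_
    exact (Finset.sum_le_sum_of_subset
      (Finset.filter_subset_filter _ (Finset.filter_subset _ _))).trans (hd' l R)
  have hsplit : ∑ Q ∈ F, K Q * ∏ i ∈ t, ∫⁻ x in s Q, f i x ∂σ i
      ≤ ∑ i ∈ t, ∑ R ∈ F, d i R * w i R * ∑' Q : {Q // s Q ⊆ s R}, a i Q * σ i (s Q) := by
    calc ∑ Q ∈ F, K Q * ∏ i ∈ t, ∫⁻ x in s Q, f i x ∂σ i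
        ≤ ∑ Q ∈ F, K Q * ((∏ i ∈ t, σ i (s Q)) *
            ∑ R ∈ F.filter (fun R => s Q ⊆ s R), ∑ i ∈ t, d i R * w i R) := by
          refine Finset.sum_le_sum fun Q hQ => ?_
          gcongr
          refine (Finset.prod_le_prod' fun i _ => havg i Q).trans ?_
          rw [Finset.prod_mul_distrib]
          gcongr
          exact hprod Q hQ
      _ = ∑ i ∈ t, ∑ R ∈ F, d i R * w i R *
            ∑ Q ∈ F.filter (fun Q => s Q ⊆ s R), a i Q * σ i (s Q) := by
          have hb : ∀ i ∈ t, ∀ Q, a i Q * σ i (s Q) = K Q * ∏ j ∈ t, σ j (s Q) :=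
            fun i hi Q => by
              rw [← Finset.mul_prod_erase t _ hi, ha]
              ring
          rw [Finset.sum_comm (s := t)]
          simp_rw [Finset.sum_filter, Finset.mul_sum]
          rw [Finset.sum_comm]
          refine Finset.sum_congr rfl fun R _ => ?_
          rw [Finset.sum_comm (s := t)]
          refine Finset.sum_congr rfl fun Q _ => ?_
          split_ifs
          · rw [Finset.mul_sum, Finset.mul_sum]
            refine Finset.sum_congr rfl fun i hi => ?_
            rw [hb i hi]
            ring
          · simp
      _ ≤ _ := by
          refine Finset.sum_le_sum fun i _ => Finset.sum_le_sum fun R _ => ?_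
          gcongr
          exact sum_inside_le _ F R
  have hterm : ∀ i ∈ t, ∑ R ∈ F, d i R * w i R * ∑' Q : {Q // s Q ⊆ s R}, a i Q * σ i (s Q)
      ≤ (maxConst (q i) * wolffConst (q i)) ^ (1 / q i) *
        (∏ j ∈ t, maxConst (P j) ^ (1 / P j)) * c *
          ∏ j ∈ t, (∫⁻ x, f j x ^ P j ∂σ j) ^ (1 / P j) := by
    intro i hi
    have hq0 : 0 < q i := (hpq i hi).symm.pos
    refine (sum_increments_mul_le hs (hfin i) (hpq i hi) (a i) F (d i) (w i) (hMm i)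
      (sum_increments_le_of_mem hs (hd i) (hu_le i))
      fun Q R hQR => Finset.prod_le_prod' fun l _ => hu_mono l Q R hQR).trans ?_
    have hpow : ∀ j, ∫⁻ x, (maxFn s (σ j) (f j) x ^ q i) ^ (P j / q i) ∂σ j
        = ∫⁻ x, maxFn s (σ j) (f j) x ^ P j ∂σ j := fun j => by
      simp_rw [← ENNReal.rpow_mul, mul_div_cancel₀ _ hq0.ne']
    have hE := h i hi (fun j x => maxFn s (σ j) (f j) x ^ q i) (fun j => (hMm j).pow_const _)
      (fun j hj => by
        have hj' := Finset.mem_of_mem_erase hj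
        rw [hpow]
        exact ne_top_of_le_ne_top (ENNReal.mul_ne_top (maxConst_ne_top (hpq j hj').lt)
          (hffin j hj')) (hMax j hj'))
    simp_rw [hpow] at hE
    have hX : ∑' Q, a i Q * σ i (s Q) * avgSum s (σ i) (a i) Q ^ (q i - 1) * w i Q ^ q i
        ≤ (c * ∏ j ∈ t.erase i, (∫⁻ x, maxFn s (σ j) (f j) x ^ P j ∂σ j) ^ (1 / P j)) ^ q i := by
      refine le_trans (ENNReal.tsum_le_tsum fun Q => ?_) (hE.trans_eq ?_)
      · rw [stepKernel_eq σ (q i) hi]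
        calc a i Q * σ i (s Q) * avgSum s (σ i) (a i) Q ^ (q i - 1) * w i Q ^ q i
            = K Q * σ i (s Q) * avgSum s (σ i) (a i) Q ^ (q i - 1) *
                ∏ j ∈ t.erase i, u j Q ^ q i * σ j (s Q) := by
              rw [hw, Finset.prod_mul_distrib, ENNReal.prod_rpow_of_nonneg hq0.le]
              simp only [ha]
              ring
          _ ≤ _ := by
              gcongr with j hj
              exact mul_measure_le_setLIntegral hs fun x hx =>
                ENNReal.rpow_le_rpow (hu_le j Q x hx) hq0.le
      · rw [ENNReal.mul_rpow_of_nonneg _ _ hq0.le, ← ENNReal.prod_rpow_of_nonneg hq0.le]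
        congr 1
        refine Finset.prod_congr rfl fun j _ => ?_
        rw [← ENNReal.rpow_mul]
        congr 1
        field_simp
    calc _ ≤ (∫⁻ x, maxFn s (σ i) (f i) x ^ P i ∂σ i) ^ (1 / P i) *
          (maxConst (q i) * (wolffConst (q i) * (c * ∏ j ∈ t.erase i,
            (∫⁻ x, maxFn s (σ j) (f j) x ^ P j ∂σ j) ^ (1 / P j)) ^ q i)) ^ (1 / q i) := by
          gcongr
      _ = (maxConst (q i) * wolffConst (q i)) ^ (1 / q i) * c *
          ∏ j ∈ t, (∫⁻ x, maxFn s (σ j) (f j) x ^ P j ∂σ j) ^ (1 / P j) := by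
          rw [← Finset.mul_prod_erase t _ hi, ← mul_assoc (maxConst _),
            ENNReal.mul_rpow_of_nonneg _ _ (by positivity : 0 ≤ 1 / q i), ← ENNReal.rpow_mul,
            mul_one_div_cancel hq0.ne', ENNReal.rpow_one]
          ring
      _ ≤ (maxConst (q i) * wolffConst (q i)) ^ (1 / q i) * c *
          ∏ j ∈ t, (maxConst (P j) ^ (1 / P j) * (∫⁻ x, f j x ^ P j ∂σ j) ^ (1 / P j)) := by
          gcongr with j hj
          have := (hpq j hj).pos
          rw [← ENNReal.mul_rpow_of_nonneg _ _ (by positivity)]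
          exact ENNReal.rpow_le_rpow (hMax j hj) (by positivity)
      _ = _ := by
          rw [Finset.prod_mul_distrib]
          ring
  refine hsplit.trans ((Finset.sum_le_sum hterm).trans_eq ?_)
  unfold combineConst
  rw [Finset.sum_mul, Finset.sum_mul]

end Embedding

/-! ### Dyadic cubes -/

theorem cube_subset_of_le {d : ℕ} {k l : ℤ} (hkl : k ≤ l) {m n : Fin d → ℤ}
    (h : (cube k m ∩ cube l n).Nonempty) : cube l n ⊆ cube k m := by
  obtain ⟨x, hxk, hxl⟩ := h
  obtain ⟨e, rfl⟩ := Int.le.dest hkl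
  have hpos : (0 : ℝ) < 2 ^ (-(k + e)) := by positivity
  have hscale : (2 : ℝ) ^ (-k) = 2 ^ (-(k + (e : ℤ))) * ((2 ^ e : ℤ) : ℝ) := by
    push_cast
    rw [← zpow_natCast, ← zpow_add₀ two_ne_zero]
    congr 1
    ring
  intro y hy i
  obtain ⟨hk1, hk2⟩ := hxk i
  obtain ⟨hl1, hl2⟩ := hxl i
  obtain ⟨hy1, hy2⟩ := hy i
  rw [hscale, mul_assoc] at hk1 hk2 ⊢
  -- Both cubes have vertices in the finer lattice, where the bounds are inequalities of integers.
  have h1 : 2 ^ e * m i < n i + 1 := by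
    have := lt_of_mul_lt_mul_left (hk1.trans_lt hl2) hpos.le
    exact_mod_cast this
  have h2 : n i < 2 ^ e * (m i + 1) := by
    have := lt_of_mul_lt_mul_left (hl1.trans_lt hk2) hpos.le
    exact_mod_cast this
  have h1' : ((2 ^ e : ℤ) : ℝ) * (m i : ℝ) ≤ n i := by exact_mod_cast Int.lt_add_one_iff.1 h1
  have h2' : (n i : ℝ) + 1 ≤ ((2 ^ e : ℤ) : ℝ) * ((m i : ℝ) + 1) := by
    exact_mod_cast Int.add_one_le_iff.2 h2
  rw [mul_assoc]
  exact ⟨(mul_le_mul_of_nonneg_left h1' hpos.le).trans hy1,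
    hy2.trans_le (mul_le_mul_of_nonneg_left h2' hpos.le)⟩

theorem cube_eq_pi {d : ℕ} (k : ℤ) (m : Fin d → ℤ) :
    cube k m = Set.univ.pi fun i =>
      Set.Ico ((2 : ℝ) ^ (-k) * (m i : ℝ)) ((2 : ℝ) ^ (-k) * ((m i : ℝ) + 1)) := by
  ext x
  simp [cube, Set.mem_pi]

theorem nestedFamily_dyadicCube (d : ℕ) :
    NestedFamily (fun Q : DyadicCube d => (Q : Set (Fin d → ℝ))) where
  injective := Subtype.val_injective
  nonempty := by
    rintro ⟨_, k, m, rfl⟩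
    refine ⟨fun i => (2 : ℝ) ^ (-k) * (m i : ℝ), fun i => ⟨le_rfl, ?_⟩⟩
    have : (0 : ℝ) < 2 ^ (-k) := by positivity
    simp only
    gcongr
    linarith
  measurable := by
    rintro ⟨_, k, m, rfl⟩
    simp only [cube_eq_pi]
    exact MeasurableSet.univ_pi fun i => measurableSet_Ico
  nested := by
    rintro ⟨_, k, m, rfl⟩ ⟨_, l, n, rfl⟩ h
    rcases le_total k l with hkl | hkl
    · exact Or.inr (cube_subset_of_le hkl h)
    · exact Or.inl (cube_subset_of_le hkl (Set.inter_comm _ _ ▸ h))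

instance (d : ℕ) : Countable (DyadicCube d) := by
  have : Function.Surjective
      (fun z : ℤ × (Fin d → ℤ) => (⟨cube z.1 z.2, z.1, z.2, rfl⟩ : DyadicCube d)) := by
    rintro ⟨_, k, m, rfl⟩
    exact ⟨(k, m), rfl⟩
  exact this.countable

theorem measure_dyadicCube_ne_top {d : ℕ} (μ : Measure (Fin d → ℝ)) [IsLocallyFiniteMeasure μ]
    (Q : DyadicCube d) : μ (Q : Set (Fin d → ℝ)) ≠ ∞ := by
  obtain ⟨_, k, m, rfl⟩ := Q
  have hcomp : IsCompact (Set.univ.pi fun i =>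
      Set.Icc ((2 : ℝ) ^ (-k) * (m i : ℝ)) ((2 : ℝ) ^ (-k) * ((m i : ℝ) + 1))) :=
    isCompact_univ_pi fun i => isCompact_Icc
  refine ne_top_of_le_ne_top (hcomp.measure_lt_top (μ := μ)).ne ?_
  refine measure_mono ((cube_eq_pi k m).subset.trans ?_)
  exact (Set.pi_mono fun i _ => Set.Ico_subset_Icc_self)

/-! ### Exponents and kernels along a permutation -/

section Permutation

variable {n : ℕ}

/-- The indices `φ(j), φ(j + 1), …` (counted from `0`) that are not yet eliminated after `j` steps
in the order given by `φ`. -/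
def remaining (φ : Equiv.Perm (Fin n)) (j : ℕ) : Finset (Fin n) :=
  (Finset.univ.filter fun i : Fin n => j ≤ (i : ℕ)).map φ.toEmbedding

theorem mem_remaining {φ : Equiv.Perm (Fin n)} {j : ℕ} {l : Fin n} :
    l ∈ remaining φ j ↔ j ≤ (φ.symm l : ℕ) := by
  simp [remaining]

theorem remaining_zero (φ : Equiv.Perm (Fin n)) : remaining φ 0 = Finset.univ := by
  ext l
  simp [mem_remaining]

theorem remaining_self (φ : Equiv.Perm (Fin n)) : remaining φ n = ∅ := by
  ext l
  simp [mem_remaining]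

theorem apply_mem_remaining (φ : Equiv.Perm (Fin n)) {j : ℕ} (hj : j < n) :
    φ ⟨j, hj⟩ ∈ remaining φ j := by
  simp [mem_remaining]

theorem remaining_succ (φ : Equiv.Perm (Fin n)) {j : ℕ} (hj : j < n) :
    remaining φ (j + 1) = (remaining φ j).erase (φ ⟨j, hj⟩) := by
  ext l
  rw [Finset.mem_erase, mem_remaining, mem_remaining, Ne, ← Equiv.symm_apply_eq, Fin.ext_iff]
  simp only
  omega

theorem remaining_subset_of_agree {φ ψ : Equiv.Perm (Fin n)} {j : ℕ}
    (h : ∀ i : Fin n, (i : ℕ) < j → φ i = ψ i) : remaining φ j ⊆ remaining ψ j := by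
  intro l hl
  rw [mem_remaining] at hl ⊢
  by_contra hcon
  have h1 := h (ψ.symm l) (not_le.1 hcon)
  rw [Equiv.apply_symm_apply] at h1
  rw [← h1, Equiv.symm_apply_apply] at hl
  exact hcon hl

theorem remaining_eq_of_agree {φ ψ : Equiv.Perm (Fin n)} {j : ℕ}
    (h : ∀ i : Fin n, (i : ℕ) < j → φ i = ψ i) : remaining φ j = remaining ψ j :=
  (remaining_subset_of_agree h).antisymm (remaining_subset_of_agree fun i hi => (h i hi).symm)

/-- Any remaining index can be eliminated next. -/
theorem exists_agree_apply_eq (φ : Equiv.Perm (Fin n)) {j : ℕ} (hj : j < n) {l : Fin n}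
    (hl : l ∈ remaining φ j) :
    ∃ ψ : Equiv.Perm (Fin n), (∀ i : Fin n, (i : ℕ) < j → φ i = ψ i) ∧ ψ ⟨j, hj⟩ = l := by
  rw [mem_remaining] at hl
  refine ⟨(Equiv.swap ⟨j, hj⟩ (φ.symm l)).trans φ, fun i hi => ?_, by simp⟩
  rw [Equiv.trans_apply, Equiv.swap_apply_of_ne_of_ne]
  · exact fun h => by simp [h] at hi
  · exact fun h => by rw [h] at hi; omega

theorem inv_rExp (p : Fin n → ℝ) (φ : Equiv.Perm (Fin n)) (j : ℕ) :
    (rExp p φ j)⁻¹ = 1 - ∑ i, 1 / p i + ∑ i ∈ remaining φ j, 1 / p i := by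
  unfold rExp remaining
  rw [inv_inv, Finset.sum_map, ← Equiv.sum_comp φ,
    ← Finset.sum_filter_add_sum_filter_not Finset.univ (fun i : Fin n => (i : ℕ) < j)]
  simp only [not_lt, Equiv.coe_toEmbedding]
  ring

theorem rExp_eq_of_remaining_eq (p : Fin n → ℝ) {φ ψ : Equiv.Perm (Fin n)} {j : ℕ}
    (h : remaining φ j = remaining ψ j) : rExp p φ j = rExp p ψ j := by
  rw [← inv_inj, inv_rExp, inv_rExp, h]

variable {p : Fin n → ℝ}

theorem one_div_lt_inv_rExp (hp : ∀ i, 1 < p i) (hsum : ∑ i, 1 / p i < 1)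
    {φ : Equiv.Perm (Fin n)} {j : ℕ} {l : Fin n} (hl : l ∈ remaining φ j) :
    1 / p l < (rExp p φ j)⁻¹ := by
  rw [inv_rExp]
  have : 1 / p l ≤ ∑ i ∈ remaining φ j, 1 / p i :=
    Finset.single_le_sum (f := fun i => 1 / p i)
      (fun i _ => by have := hp i; positivity) hl
  linarith

theorem rExp_pos (hp : ∀ i, 1 < p i) (hsum : ∑ i, 1 / p i < 1)
    (φ : Equiv.Perm (Fin n)) (j : ℕ) : 0 < rExp p φ j := by
  rw [← inv_pos, inv_rExp]
  have : 0 ≤ ∑ i ∈ remaining φ j, 1 / p i :=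
    Finset.sum_nonneg fun i _ => by have := hp i; positivity
  linarith

theorem rExp_lt (hp : ∀ i, 1 < p i) (hsum : ∑ i, 1 / p i < 1)
    {φ : Equiv.Perm (Fin n)} {j : ℕ} {l : Fin n} (hl : l ∈ remaining φ j) :
    rExp p φ j < p l := by
  have h := one_div_lt_inv_rExp hp hsum hl
  rw [one_div] at h
  exact (inv_lt_inv₀ (by have := hp l; linarith) (rExp_pos hp hsum φ j)).1 h

theorem rExp_zero (p : Fin n → ℝ) (φ : Equiv.Perm (Fin n)) : rExp p φ 0 = 1 := by
  simp [rExp]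

/-- The ratio of consecutive exponents is conjugate to the rescaled exponent of the measure that is
eliminated. -/
theorem holderConjugate_rExp (hp : ∀ i, 1 < p i) (hsum : ∑ i, 1 / p i < 1)
    (φ : Equiv.Perm (Fin n)) {j : ℕ} (hj : j < n) :
    (p (φ ⟨j, hj⟩) / rExp p φ j).HolderConjugate (rExp p φ (j + 1) / rExp p φ j) := by
  have hr := rExp_pos hp hsum φ j
  have hr' := rExp_pos hp hsum φ (j + 1)
  have hmem := apply_mem_remaining φ hj
  have hpl : 0 < p (φ ⟨j, hj⟩) := by have := hp (φ ⟨j, hj⟩); linarith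
  rw [Real.holderConjugate_iff]
  refine ⟨by rw [lt_div_iff₀ hr, one_mul]; exact rExp_lt hp hsum hmem, ?_⟩
  have h1 := inv_rExp p φ j
  have h2 := inv_rExp p φ (j + 1)
  rw [← Finset.add_sum_erase _ _ hmem, ← remaining_succ φ hj] at h1
  have h3 : (p (φ ⟨j, hj⟩))⁻¹ + (rExp p φ (j + 1))⁻¹ = (rExp p φ j)⁻¹ := by
    rw [h1, h2]; ring
  rw [inv_div, inv_div, div_eq_mul_inv, div_eq_mul_inv, ← mul_add, h3, mul_inv_cancel₀ hr.ne']

variable {d : ℕ}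

theorem kernel_succ (p : Fin n → ℝ) (K : DyadicCube d → ℝ≥0) (σ : Fin n → Measure (Fin d → ℝ))
    (φ : Equiv.Perm (Fin n)) {j : ℕ} (hj : j + 1 ≤ n) :
    kernel p K σ φ (j + 1) hj =
      stepKernel (fun Q : DyadicCube d => (Q : Set (Fin d → ℝ))) (σ (φ ⟨j, hj⟩))
        (rExp p φ (j + 1) / rExp p φ j) (fun Q => ∏ i ∈ remaining φ j, σ i Q)
        (kernel p K σ φ j (Nat.le_of_succ_le hj)) := by
  funext Q
  simp only [kernel, stepKernel, remaining, Finset.prod_map, Equiv.coe_toEmbedding]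

theorem kernel_eq_of_agree (p : Fin n → ℝ) (K : DyadicCube d → ℝ≥0)
    (σ : Fin n → Measure (Fin d → ℝ)) {φ ψ : Equiv.Perm (Fin n)} {j : ℕ} (hj : j ≤ n)
    (h : ∀ i : Fin n, (i : ℕ) < j → φ i = ψ i) :
    kernel p K σ φ j hj = kernel p K σ ψ j hj := by
  induction j with
  | zero => rfl
  | succ j ih =>
    have h' : ∀ i : Fin n, (i : ℕ) < j → φ i = ψ i := fun i hi => h i (hi.trans j.lt_succ_self)
    rw [kernel_succ, kernel_succ, ih _ h', remaining_eq_of_agree h', h ⟨j, hj⟩ j.lt_succ_self,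
      rExp_eq_of_remaining_eq p (remaining_eq_of_agree h'),
      rExp_eq_of_remaining_eq p (remaining_eq_of_agree h)]

end Permutation

/-! ### Iterated elimination -/

theorem maxConst_pow_ne_top {p e : ℝ} (hp : 1 < p) (he : 0 ≤ e) : maxConst p ^ e ≠ ∞ :=
  ENNReal.rpow_ne_top_of_nonneg he (maxConst_ne_top hp)

theorem eliminateConst_ne_top {κ : Type*} [DecidableEq κ] {P : κ → ℝ} {t : Finset κ} {i : κ}
    {q : ℝ} (hq : 1 < q) (hP : ∀ j ∈ t.erase i, q < P j) : eliminateConst P t i q ≠ ∞ := by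
  have hq0 : 0 < q := by linarith
  unfold eliminateConst
  refine ENNReal.mul_ne_top (maxConst_pow_ne_top hq ?_) (ENNReal.prod_ne_top fun j hj =>
    maxConst_pow_ne_top ?_ ?_)
  · rw [sub_nonneg, div_le_one hq0]
    exact hq.le
  · rw [lt_div_iff₀ hq0, one_mul]
    exact hP j hj
  · have := hq0.trans (hP j hj)
    positivity

theorem combineConst_ne_top {κ : Type*} {P : κ → ℝ} {t : Finset κ} {q : κ → ℝ}
    (hpq : ∀ i ∈ t, (P i).HolderConjugate (q i)) : combineConst P t q ≠ ∞ := by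
  unfold combineConst
  refine ENNReal.sum_ne_top.2 fun i hi => ENNReal.mul_ne_top ?_ (ENNReal.prod_ne_top fun j hj => ?_)
  · have := (hpq i hi).symm.pos
    exact ENNReal.rpow_ne_top_of_nonneg (by positivity)
      (ENNReal.mul_ne_top (maxConst_ne_top (hpq i hi).symm.lt)
        (wolffConst_ne_top (hpq i hi).symm.lt))
  · have := (hpq j hj).pos
    exact maxConst_pow_ne_top (hpq j hj).lt (by positivity)

section Iteration

variable {n : ℕ} {p : Fin n → ℝ}

theorem div_rExp_div (hp : ∀ i, 1 < p i) (hsum : ∑ i, 1 / p i < 1) (φ : Equiv.Perm (Fin n))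
    (j : ℕ) : (fun l => p l / rExp p φ j / (rExp p φ (j + 1) / rExp p φ j))
      = fun l => p l / rExp p φ (j + 1) := by
  have := rExp_pos hp hsum φ j
  have := rExp_pos hp hsum φ (j + 1)
  funext l
  field_simp

/-- The embedding implies the embeddings with the transformed kernels `K^φ_j` for the measures not
yet eliminated. -/
theorem exists_posEmbedding_kernel (hp : ∀ i, 1 < p i) (hsum : ∑ i, 1 / p i < 1)
    (φ : Equiv.Perm (Fin n)) (j : ℕ) (hj : j ≤ n) :
    ∃ C : ℝ≥0∞, C ≠ ∞ ∧ ∀ (d : ℕ) (K : DyadicCube d → ℝ≥0) (σ : Fin n → Measure (Fin d → ℝ)),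
      (∀ i, IsLocallyFiniteMeasure (σ i)) → ∀ c : ℝ≥0∞,
      PosEmbedding (fun Q : DyadicCube d => (Q : Set (Fin d → ℝ))) σ p Finset.univ
        (fun Q => (K Q : ℝ≥0∞)) c →
      PosEmbedding (fun Q : DyadicCube d => (Q : Set (Fin d → ℝ))) σ
        (fun i => p i / rExp p φ j) (remaining φ j) (kernel p K σ φ j hj) (C * c ^ rExp p φ j) := by
  induction j with
  | zero =>
    refine ⟨1, by simp, fun d K σ _ c h => ?_⟩
    simp only [rExp_zero, div_one, remaining_zero, one_mul, ENNReal.rpow_one]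
    exact h
  | succ j ih =>
    obtain ⟨C, hC, hCE⟩ := ih (Nat.le_of_succ_le hj)
    have hr := rExp_pos hp hsum φ j
    have hpq := holderConjugate_rExp hp hsum φ hj
    set q := rExp p φ (j + 1) / rExp p φ j with hq
    have hq0 : 0 < q := hpq.symm.pos
    have hP : ∀ l ∈ (remaining φ j).erase (φ ⟨j, hj⟩), q < p l / rExp p φ j := fun l hl => by
      rw [← remaining_succ φ hj] at hl
      exact div_lt_div_of_pos_right (rExp_lt hp hsum hl) hr
    refine ⟨eliminateConst (fun i => p i / rExp p φ j) (remaining φ j) (φ ⟨j, hj⟩) q * C ^ q,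
      ENNReal.mul_ne_top (eliminateConst_ne_top hpq.symm.lt hP)
        (ENNReal.rpow_ne_top_of_nonneg hq0.le hC), fun d K σ hσ c h => ?_⟩
    have h' := (hCE d K σ hσ c h).eliminate (nestedFamily_dyadicCube d)
      (fun i Q => measure_dyadicCube_ne_top (σ i) Q) (apply_mem_remaining φ hj) hpq hP
    rw [← kernel_succ p K σ φ hj, ← remaining_succ φ hj, hq, div_rExp_div hp hsum, ← hq,
      ENNReal.mul_rpow_of_nonneg _ _ hq0.le, ← ENNReal.rpow_mul, ← mul_assoc] at h'
    have hexp : rExp p φ j * q = rExp p φ (j + 1) := by rw [hq]; field_simp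
    rwa [hexp] at h'

theorem PosEmbedding.mono {X ι κ : Type*} [MeasurableSpace X] {s : ι → Set X} {σ : κ → Measure X}
    {P : κ → ℝ} {t : Finset κ} {K : ι → ℝ≥0∞} {c c' : ℝ≥0∞} (h : PosEmbedding s σ P t K c)
    (hc : c ≤ c') : PosEmbedding s σ P t K c' := fun f hf hf' =>
  (h f hf hf').trans (by gcongr)

/-- Bounds for the sums of the fully transformed kernels, in all orders of elimination, imply the
embeddings with the kernels `K^φ_j`; the case `j = 0` is the original embedding. -/
theorem exists_posEmbedding_of_tsum_kernel_le (hp : ∀ i, 1 < p i) (hsum : ∑ i, 1 / p i < 1)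
    (j : ℕ) (hj : j ≤ n) :
    ∃ C : ℝ≥0∞, C ≠ ∞ ∧ ∀ (d : ℕ) (K : DyadicCube d → ℝ≥0) (σ : Fin n → Measure (Fin d → ℝ)),
      (∀ i, IsLocallyFiniteMeasure (σ i)) → ∀ c : ℝ≥0∞,
      (∀ φ : Equiv.Perm (Fin n), ∑' Q, kernel p K σ φ n le_rfl Q ≤ c ^ rExp p φ n) →
      ∀ φ : Equiv.Perm (Fin n), PosEmbedding (fun Q : DyadicCube d => (Q : Set (Fin d → ℝ))) σ
        (fun i => p i / rExp p φ j) (remaining φ j) (kernel p K σ φ j hj) (C * c ^ rExp p φ j) := by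
  induction hj using Nat.decreasingInduction with
  | self =>
    refine ⟨1, by simp, fun d K σ _ c h φ f _ _ => ?_⟩
    simpa [remaining_self] using h φ
  | of_succ j hj ih =>
    obtain ⟨C, hC, hCE⟩ := ih
    set P : Equiv.Perm (Fin n) → Fin n → ℝ := fun φ i => p i / rExp p φ j with hP
    have hpq : ∀ φ, ∀ i ∈ remaining φ j, (P φ i).HolderConjugate (P φ i).conjExponent :=
      fun φ i hi => Real.HolderConjugate.conjExponent <| by
        rw [hP, lt_div_iff₀ (rExp_pos hp hsum φ j), one_mul]
        exact rExp_lt hp hsum hi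
    refine ⟨(∑ φ, combineConst (P φ) (remaining φ j) fun i => (P φ i).conjExponent) * max 1 C,
      ENNReal.mul_ne_top (ENNReal.sum_ne_top.2 fun φ _ => combineConst_ne_top (hpq φ))
        (max_lt (by simp) hC.lt_top).ne, fun d K σ hσ c h φ => ?_⟩
    have hstep := PosEmbedding.of_eliminate (nestedFamily_dyadicCube d)
      (fun i Q => measure_dyadicCube_ne_top (σ i) Q) ⟨_, apply_mem_remaining φ hj⟩ (hpq φ)
      (K := kernel p K σ φ j hj.le) (c := max 1 C * c ^ rExp p φ j) ?_
    · refine hstep.mono ?_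
      rw [← mul_assoc]
      gcongr
      exact Finset.single_le_sum (f := fun φ =>
        combineConst (P φ) (remaining φ j) fun i => (P φ i).conjExponent)
        (fun _ _ => zero_le) (Finset.mem_univ φ)
    · intro i hi
      obtain ⟨ψ, hψ, rfl⟩ := exists_agree_apply_eq φ hj hi
      have hrem := remaining_eq_of_agree hψ
      have hr := rExp_eq_of_remaining_eq p hrem
      have hconj := holderConjugate_rExp hp hsum ψ hj
      have hPψ : P φ = fun i => p i / rExp p ψ j := by rw [hP, ← hr]
      have hq : (P φ (ψ ⟨j, hj⟩)).conjExponent = rExp p ψ (j + 1) / rExp p ψ j := by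
        rw [hPψ]
        exact hconj.conjExponent_eq
      have h' := hCE d K σ hσ c h ψ
      rw [kernel_succ, ← div_rExp_div hp hsum, remaining_succ ψ hj, ← kernel_eq_of_agree p K σ _ hψ,
        ← hrem, ← hq] at h'
      have hr0 := rExp_pos hp hsum ψ j
      have hq1 : 1 < (P φ (ψ ⟨j, hj⟩)).conjExponent := hq ▸ hconj.symm.lt
      have hexp : rExp p ψ j * (P φ (ψ ⟨j, hj⟩)).conjExponent = rExp p ψ (j + 1) := by
        rw [hq]; field_simp
      simp only [hPψ, hr] at h' hq1 hexp ⊢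
      refine h'.mono ?_
      rw [ENNReal.mul_rpow_of_nonneg _ _ (by linarith), ← ENNReal.rpow_mul, hexp]
      gcongr
      refine (le_max_right 1 C).trans ?_
      conv_lhs => rw [← ENNReal.rpow_one (max 1 C)]
      exact ENNReal.rpow_le_rpow_of_exponent_le (le_max_left _ _) hq1.le

end Iteration

/-! ### Least constants and the comparison of the two conditions -/

section Comparison

variable {n d : ℕ} {p : Fin n → ℝ}

theorem eLpNorm_ofReal_eq {X E : Type*} [MeasurableSpace X] [ENorm E] {μ : Measure X} {e : ℝ}
    (he : 0 < e) (f : X → E) :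
    eLpNorm f (ENNReal.ofReal e) μ = (∫⁻ x, ‖f x‖ₑ ^ e ∂μ) ^ (1 / e) := by
  rw [eLpNorm_eq_lintegral_rpow_enorm_toReal (by simpa using he) ENNReal.ofReal_ne_top,
    ENNReal.toReal_ofReal he.le]

theorem Embedding.posEmbedding (hp : ∀ i, 1 < p i) {K : DyadicCube d → ℝ≥0}
    {σ : Fin n → Measure (Fin d → ℝ)} [∀ i, IsLocallyFiniteMeasure (σ i)] {c : ℝ≥0}
    (h : Embedding p K σ c) :
    PosEmbedding (fun Q : DyadicCube d => (Q : Set (Fin d → ℝ))) σ p Finset.univ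
      (fun Q => (K Q : ℝ≥0∞)) c := by
  intro g hg hgfin
  have hp0 : ∀ i, 0 < p i := fun i => by linarith [hp i]
  have hlt : ∀ i, ∀ᵐ x ∂σ i, g i x < ∞ := fun i => by
    filter_upwards [ae_lt_top ((hg i).pow_const (p i)) (hgfin i (Finset.mem_univ i))] with x hx
    rw [lt_top_iff_ne_top] at hx ⊢
    exact fun hcon => hx (by rw [hcon, ENNReal.top_rpow_of_pos (hp0 i)])
  have hnorm : ∀ i, eLpNorm (fun x => (g i x).toReal) (ENNReal.ofReal (p i)) (σ i)
      = (∫⁻ x, g i x ^ p i ∂σ i) ^ (1 / p i) := fun i => by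
    rw [eLpNorm_ofReal_eq (hp0 i)]
    congr 1
    refine lintegral_congr_ae ?_
    filter_upwards [hlt i] with x hx
    rw [Real.enorm_eq_ofReal ENNReal.toReal_nonneg, ENNReal.ofReal_toReal hx.ne]
  have hint : ∀ i (Q : DyadicCube d), ‖∫ x in (Q : Set (Fin d → ℝ)), (g i x).toReal ∂σ i‖ₑ
      = ∫⁻ x in (Q : Set (Fin d → ℝ)), g i x ∂σ i := fun i Q => by
    rw [integral_toReal (hg i).aemeasurable (ae_restrict_of_ae (hlt i)),
      Real.enorm_eq_ofReal ENNReal.toReal_nonneg, ENNReal.ofReal_toReal]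
    rw [← measure_mul_average (s := fun Q : DyadicCube d => (Q : Set (Fin d → ℝ)))
      (measure_dyadicCube_ne_top (σ i)) (g i) Q]
    exact ENNReal.mul_ne_top (measure_dyadicCube_ne_top (σ i) Q)
      (average_ne_top (s := fun Q : DyadicCube d => (Q : Set (Fin d → ℝ))) (hp i)
        (hg i).aemeasurable (measure_dyadicCube_ne_top (σ i)) (hgfin i (Finset.mem_univ i)) Q)
  have h' := h (fun i x => (g i x).toReal) fun i =>
    ⟨(hg i).ennreal_toReal.aestronglyMeasurable, by
      rw [hnorm]
      exact ENNReal.rpow_lt_top_of_nonneg (by have := hp0 i; positivity)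
        (hgfin i (Finset.mem_univ i))⟩
  simp_rw [hnorm, hint] at h'
  exact h'

theorem PosEmbedding.embedding (hp : ∀ i, 1 < p i) {K : DyadicCube d → ℝ≥0}
    {σ : Fin n → Measure (Fin d → ℝ)} {c : ℝ≥0}
    (h : PosEmbedding (fun Q : DyadicCube d => (Q : Set (Fin d → ℝ))) σ p Finset.univ
      (fun Q => (K Q : ℝ≥0∞)) c) :
    Embedding p K σ c := by
  intro f hf
  have hp0 : ∀ i, 0 < p i := fun i => by linarith [hp i]
  set g : Fin n → (Fin d → ℝ) → ℝ≥0∞ := fun i x => ‖(hf i).aestronglyMeasurable.mk (f i) x‖ₑ with hg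
  have hae : ∀ i, (fun x => ‖f i x‖ₑ) =ᵐ[σ i] g i := fun i => by
    filter_upwards [(hf i).aestronglyMeasurable.ae_eq_mk] with x hx
    exact congrArg (‖·‖ₑ) hx
  have hnorm : ∀ i, eLpNorm (f i) (ENNReal.ofReal (p i)) (σ i)
      = (∫⁻ x, g i x ^ p i ∂σ i) ^ (1 / p i) := fun i => by
    rw [eLpNorm_ofReal_eq (hp0 i)]
    congr 1
    refine lintegral_congr_ae ?_
    filter_upwards [hae i] with x hx
    rw [hx]
  have h' := h g (fun i => (hf i).aestronglyMeasurable.stronglyMeasurable_mk.measurable.enorm) fun i _ => by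
    intro hcon
    have h1 := (hf i).2.ne
    rw [hnorm, hcon] at h1
    exact h1 (ENNReal.top_rpow_of_pos (by have := hp0 i; positivity))
  simp_rw [hnorm]
  refine le_trans (ENNReal.tsum_le_tsum fun Q => ?_) h'
  gcongr with i
  refine (enorm_integral_le_lintegral_enorm _).trans_eq ?_
  exact lintegral_congr_ae (ae_restrict_of_ae (hae i))

theorem isLeast_sInf_of_isClosed {S : Set ℝ≥0} (hS : IsClosed S) (hne : S.Nonempty) :
    IsLeast S (sInf S) :=
  ⟨hS.csInf_mem hne (OrderBot.bddBelow S), fun _ hc => csInf_le (OrderBot.bddBelow S) hc⟩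

theorem isClosed_embedding (p : Fin n → ℝ) (K : DyadicCube d → ℝ≥0)
    (σ : Fin n → Measure (Fin d → ℝ)) : IsClosed {c : ℝ≥0 | Embedding p K σ c} := by
  simp only [Embedding, Set.ofPred_forall]
  refine isClosed_iInter fun f => isClosed_iInter fun hf => ?_
  refine isClosed_le continuous_const ?_
  exact (ENNReal.continuous_mul_const (ENNReal.prod_ne_top fun i _ => (hf i).2.ne)).comp
    ENNReal.continuous_coe

theorem isClosed_wolffBound (hn : 0 < n) (p : Fin n → ℝ) (K : DyadicCube d → ℝ≥0)
    (σ : Fin n → Measure (Fin d → ℝ)) : IsClosed {c : ℝ≥0 | WolffBound hn p K σ c} := by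
  simp only [WolffBound, Set.ofPred_forall]
  exact isClosed_iInter fun φ => isClosed_le continuous_const ENNReal.continuous_coe

/-- The last step of the elimination, for a single measure: the norm in the Wolff condition is
comparable to the sum of the fully transformed kernel. -/
theorem eLpNorm_kernel_comparable (hp : ∀ i, 1 < p i) (hsum : ∑ i, 1 / p i < 1)
    (φ : Equiv.Perm (Fin n)) {j : ℕ} (hj : j + 1 = n) :
    ∃ A B : ℝ≥0∞, A ≠ ∞ ∧ B ≠ ∞ ∧ ∀ (d : ℕ) (K : DyadicCube d → ℝ≥0)
      (σ : Fin n → Measure (Fin d → ℝ)), (∀ i, IsLocallyFiniteMeasure (σ i)) →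
      ∀ N, N = eLpNorm (fun x : Fin d → ℝ =>
        (∑' Q : DyadicCube d, (Q : Set (Fin d → ℝ)).indicator
          (fun _ => kernel p K σ φ j (by omega) Q) x) ^ (1 / rExp p φ j))
        (ENNReal.ofReal (rExp p φ n)) (σ (φ ⟨j, by omega⟩)) →
      N ^ rExp p φ n ≤ A * ∑' Q, kernel p K σ φ n le_rfl Q ∧
      ∑' Q, kernel p K σ φ n le_rfl Q ≤ B * N ^ rExp p φ n := by
  subst hj
  have hj := j.lt_succ_self
  have hconj := holderConjugate_rExp hp hsum φ hj
  have hr := rExp_pos hp hsum φ j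
  have hr' := rExp_pos hp hsum φ (j + 1)
  set q := rExp p φ (j + 1) / rExp p φ j with hq
  have hq1 : 1 < q := hconj.symm.lt
  refine ⟨wolffConst q, maxConst q ^ (1 - 1 / q), wolffConst_ne_top hq1,
    maxConst_pow_ne_top hq1 ?_, fun d K σ hσ N hN => ?_⟩
  · rw [sub_nonneg, div_le_one hconj.symm.pos]
    exact hq1.le
  set μ := σ (φ ⟨j, hj⟩) with hμ
  set a := kernel p K σ φ j (by omega) with ha
  have hs := nestedFamily_dyadicCube d
  have hfin := measure_dyadicCube_ne_top μ
  have hNq : N ^ rExp p φ (j + 1)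
      = ∫⁻ x, potential (fun Q : DyadicCube d => (Q : Set (Fin d → ℝ))) a x ^ q ∂μ := by
    rw [hN, eLpNorm_ofReal_eq hr', ← ENNReal.rpow_mul, one_div_mul_cancel hr'.ne', ENNReal.rpow_one]
    refine lintegral_congr fun x => ?_
    rw [enorm_eq_self, ← ENNReal.rpow_mul, potential, hq, one_div_mul_eq_div]
  have hker : ∀ Q, kernel p K σ φ (j + 1) le_rfl Q = a Q * μ (Q : Set (Fin d → ℝ)) *
      avgSum (fun Q : DyadicCube d => (Q : Set (Fin d → ℝ))) μ a Q ^ (q - 1) := fun Q => by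
    have h := stepKernel_eq (s := fun Q : DyadicCube d => (Q : Set (Fin d → ℝ))) σ q
      (apply_mem_remaining φ hj) a Q
    simp only [← remaining_succ φ hj, remaining_self, Finset.prod_empty, mul_one] at h
    rw [kernel_succ]
    exact h
  simp_rw [hker]
  rw [hNq]
  exact ⟨lintegral_potential_rpow_le hs hfin hq1 a, tsum_mul_avgSum_rpow_le hs hfin hq1 a⟩

theorem le_mul_of_rpow_le {e : ℝ} (he : 0 < e) {N A c : ℝ≥0∞} (h : N ^ e ≤ A * c ^ e) :
    N ≤ A ^ (1 / e) * c := by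
  have h1 := ENNReal.rpow_le_rpow h (by positivity : 0 ≤ 1 / e)
  rwa [ENNReal.mul_rpow_of_nonneg _ _ (by positivity), ← ENNReal.rpow_mul, ← ENNReal.rpow_mul,
    mul_one_div_cancel he.ne', ENNReal.rpow_one, ENNReal.rpow_one] at h1

theorem exists_wolffBound_of_embedding (hn : 0 < n) (hp : ∀ i, 1 < p i)
    (hsum : ∑ i, 1 / p i < 1) :
    ∃ C : ℝ≥0, ∀ (d : ℕ) (K : DyadicCube d → ℝ≥0) (σ : Fin n → Measure (Fin d → ℝ)),
      (∀ i, IsLocallyFiniteMeasure (σ i)) → ∀ c : ℝ≥0, Embedding p K σ c →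
        WolffBound hn p K σ (C * c) := by
  choose A B hA hB hAB using fun φ =>
    eLpNorm_kernel_comparable hp hsum φ (Nat.sub_add_cancel hn)
  choose D hD hDE using fun φ => exists_posEmbedding_kernel hp hsum φ n le_rfl
  have hfin : ∀ φ, (A φ * D φ) ^ (1 / rExp p φ n) ≠ ∞ := fun φ =>
    ENNReal.rpow_ne_top_of_nonneg (by have := rExp_pos hp hsum φ n; positivity)
      (ENNReal.mul_ne_top (hA φ) (hD φ))
  refine ⟨∑ φ, ((A φ * D φ) ^ (1 / rExp p φ n)).toNNReal, fun d K σ hσ c h φ => ?_⟩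
  have h1 := hDE φ d K σ hσ c (h.posEmbedding hp) (fun _ _ => 0) (fun _ => measurable_const)
    (by simp [remaining_self])
  simp only [remaining_self, Finset.prod_empty, mul_one] at h1
  have h2 := (hAB φ d K σ hσ _ rfl).1
  refine (le_mul_of_rpow_le (rExp_pos hp hsum φ n) (A := A φ * D φ) (c := c) ?_).trans ?_
  · rw [mul_assoc]
    exact h2.trans (by gcongr)
  · push_cast
    gcongr
    refine le_trans (ENNReal.coe_toNNReal (hfin φ)).ge ?_
    exact Finset.single_le_sum (f := fun φ => (((A φ * D φ) ^ (1 / rExp p φ n)).toNNReal : ℝ≥0∞))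
      (fun _ _ => zero_le) (Finset.mem_univ φ)

theorem exists_embedding_of_wolffBound (hn : 0 < n) (hp : ∀ i, 1 < p i)
    (hsum : ∑ i, 1 / p i < 1) :
    ∃ C : ℝ≥0, ∀ (d : ℕ) (K : DyadicCube d → ℝ≥0) (σ : Fin n → Measure (Fin d → ℝ)),
      (∀ i, IsLocallyFiniteMeasure (σ i)) → ∀ c : ℝ≥0, WolffBound hn p K σ c →
        Embedding p K σ (C * c) := by
  choose A B hA hB hAB using fun φ =>
    eLpNorm_kernel_comparable hp hsum φ (Nat.sub_add_cancel hn)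
  obtain ⟨D, hD, hDE⟩ := exists_posEmbedding_of_tsum_kernel_le hp hsum 0 (Nat.zero_le n)
  set E := ∑ φ, B φ ^ (1 / rExp p φ n) with hE
  have hEfin : E ≠ ∞ := ENNReal.sum_ne_top.2 fun φ _ =>
    ENNReal.rpow_ne_top_of_nonneg (by have := rExp_pos hp hsum φ n; positivity) (hB φ)
  refine ⟨(D * E).toNNReal, fun d K σ hσ c h => PosEmbedding.embedding hp ?_⟩
  have h1 := hDE d K σ hσ (E * c) (fun φ => ?_) 1
  · simp only [rExp_zero, div_one, remaining_zero, ENNReal.rpow_one] at h1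
    rw [ENNReal.coe_mul, ENNReal.coe_toNNReal (ENNReal.mul_ne_top hD hEfin), mul_assoc]
    exact h1
  · have hr := rExp_pos hp hsum φ n
    refine ((hAB φ d K σ hσ _ rfl).2).trans ?_
    rw [ENNReal.mul_rpow_of_nonneg _ _ hr.le]
    gcongr
    · calc B φ = (B φ ^ (1 / rExp p φ n)) ^ rExp p φ n := by
            rw [← ENNReal.rpow_mul, one_div_mul_cancel hr.ne', ENNReal.rpow_one]
        _ ≤ E ^ rExp p φ n := by
            refine ENNReal.rpow_le_rpow ?_ hr.le
            exact Finset.single_le_sum (f := fun φ => B φ ^ (1 / rExp p φ n))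
              (fun _ _ => zero_le) (Finset.mem_univ φ)
    · exact h φ

end Comparison

end DyadicEmbedding

theorem theorem1p4 (n : ℕ) (hn : 0 < n) (p : Fin n → ℝ) (hp : ∀ i, 1 < p i)
    (hsum : ∑ i, 1 / p i < 1) :
    ∃ C : ℝ≥0, ∀ (d : ℕ), 0 < d → ∀ (K : DyadicEmbedding.DyadicCube d → ℝ≥0)
      (σ : Fin n → Measure (Fin d → ℝ)), (∀ i, IsLocallyFiniteMeasure (σ i)) →
      ((∃ c₁ : ℝ≥0, DyadicEmbedding.Embedding p K σ c₁) ↔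
        (∃ c₂ : ℝ≥0, DyadicEmbedding.WolffBound hn p K σ c₂)) ∧
      ((∃ c₁ : ℝ≥0, DyadicEmbedding.Embedding p K σ c₁) →
        ∃ c₁ c₂ : ℝ≥0,
          IsLeast {c : ℝ≥0 | DyadicEmbedding.Embedding p K σ c} c₁ ∧
          IsLeast {c : ℝ≥0 | DyadicEmbedding.WolffBound hn p K σ c} c₂ ∧
          c₁ ≤ C * c₂ ∧ c₂ ≤ C * c₁) := by
  obtain ⟨C, hC⟩ := DyadicEmbedding.exists_wolffBound_of_embedding hn hp hsum
  obtain ⟨C', hC'⟩ := DyadicEmbedding.exists_embedding_of_wolffBound hn hp hsum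
  refine ⟨max C C', fun d _ K σ hσ => ⟨⟨?_, ?_⟩, ?_⟩⟩
  · rintro ⟨c, h⟩
    exact ⟨_, hC d K σ hσ c h⟩
  · rintro ⟨c, h⟩
    exact ⟨_, hC' d K σ hσ c h⟩
  · rintro ⟨c, h⟩
    have h₁ := DyadicEmbedding.isLeast_sInf_of_isClosed
      (DyadicEmbedding.isClosed_embedding p K σ) ⟨c, h⟩
    have h₂ := DyadicEmbedding.isLeast_sInf_of_isClosed
      (DyadicEmbedding.isClosed_wolffBound hn p K σ) ⟨_, hC d K σ hσ c h⟩
    refine ⟨_, _, h₁, h₂, (h₁.2 (hC' d K σ hσ _ h₂.1)).trans ?_,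
      (h₂.2 (hC d K σ hσ _ h₁.1)).trans ?_⟩
    · gcongr
      exact le_max_right _ _
    · gcongr
      exact le_max_left _ _
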